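/- Let $G$ be a countable group and let $H_1\supsetneq H_2\supsetneq\cdots$ be a strictly decreasing sequence of normal subgroups of finite index in $G$ with $\bigcap_n H_n=\{e\}$. Let $(a_n)_{n\ge 1}$ be positive integers with $a_1\le [G:H_1]$ and $a_n<a_{n-1}[H_{n-1}:H_n]$ for all $n\ge 2$, such that the limit $\theta=\lim_{n\to\infty} a_n/[G:H_n]$ exists and $\theta<1$. Let $\sigma_n\colon G\to\mathrm{Sym}(G/H_n)$ be given by $\sigma_{n}(g)(cH_n)=cg^{-1}H_n$. Then $\Sigma=(\sigma_n)_{n\ge1}$ is a sofic approximation of $G$ (asymptotically multiplicative and asymptotically free), and for every integer $k>1$ there is an element $x\in\{1,\dots,k\}^G$ such that: 1. $x$ is a Toeplitz element with respect to $(H_n)$, i.e. $G=\bigcup_n \mathrm{Per}_{H_n}(x)$, where $\mathrm{Per}_{H}(x)=\{g\in G: x_{h^{-1}g}=x_g \text{ for all } h\in H\}$; 2. for every $n$, $x$ has exactly $a_n$ $H_n$-holes, i.e. exactly $a_n$ cosets of $H_n$ are disjoint from $\mathrm{Per}_{H_n}(x)$ (in other words, $x$ is non-constant on exactly $a_n$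 cosets of $H_n$); in particular $\lim_{n} \#\{H_n\text{-holes of }x\}/[G:H_n]=\theta$; 3. for the shift action $(gx)_h=x_{g^{-1}h}$, the orbit closure $\overline{Gx}$ has sofic topological entropy $$h_\Sigma(\overline{Gx},G)=\theta\log k=\lim_{n\to\infty}\frac{\#\{H_n\text{-holes of }x\}}{[G:H_n]}\log k .$$ Here $h_\Sigma(X,G)$ is the common value of $h_\Sigma(d)$ over all continuous pseudometrics $d$ on $X$ that are dynamically generating (for distinct $x,y\in X$ there is $s\in G$ with $d(sx,sy)>0$), where, with $V_n=G/H_n$, $$h_{\Sigma}(d)=\sup_{\epsilon>0}\ \inf_{F\subset G\text{ finite}}\ \inf_{\delta>0}\ \limsup_{n\to\infty}\frac{1}{|V_n|}\log N_\epsilon\bigl(\mathrm{Map}(d,F,\delta,\sigma_n),d_\infty\bigr),\qquad \log 0=-\infty;$$ $\mathrm{Map}(d,F,\delta,\sigma_n)$ is the set of maps $\varphi\colon V_n\to X$ with $\bigl(|V_n|^{-1}\sum_{v\in V_n} d(\varphi(\sigma_n(s)v),s\varphi(v))^2\bigr)^{1/2}\le\delta$ for all $s\in F$; $d_\infty(\varphi,\psi)=\max_{v}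 d(\varphi(v),\psi(v))$; and $N_\epsilon(Y,\rho)$ is the maximal cardinality of a subset of $Y$ whose distinct points are at $\rho$-distance greater than $\epsilon$. -/

import Mathlib

open Filter Topology

universe u v w

noncomputable section

namespace ToeplitzSofic

/-! ### Full shifts and orbit closures -/

/-- The full shift `k^G` over the alphabet `Fin k` (a set with `k` letters). -/
def FullShift (k : ℕ) (G : Type u) : Type u := G → Fin k

/-- The product topology of the discrete topologies on the alphabet. -/
instance (k : ℕ) (G : Type u) : TopologicalSpace (FullShift k G) :=
  inferInstanceAs (TopologicalSpace (G → Fin k))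

/-- The shift action `(g x)_h = x_{g⁻¹ h}`. -/
instance (k : ℕ) (G : Type u) [Group G] : MulAction G (FullShift k G) where
  smul g x := fun h => x (g⁻¹ * h)
  one_smul x := by
    funext h
    change x (1⁻¹ * h) = x h
    simp
  mul_smul s t x := by
    funext h
    change x ((s * t)⁻¹ * h) = x (t⁻¹ * (s⁻¹ * h))
    simp [mul_assoc]

theorem FullShift.smul_apply {k : ℕ} {G : Type u} [Group G] (g : G) (x : FullShift k G) (h : G) :
    (g • x) h = x (g⁻¹ * h) := rfl

instance (k : ℕ) (G : Type u) [Group G] : ContinuousConstSMul G (FullShift k G) where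
  continuous_const_smul g := continuous_pi fun h => continuous_apply (g⁻¹ * h)

/-- The orbit closure of `x` in the full shift, as an invariant subset. With the subspace topology
and the restricted action it is a subsystem of the full shift. -/
def orbitClosure {k : ℕ} {G : Type u} [Group G] (x : FullShift k G) :
    SubMulAction G (FullShift k G) where
  carrier := closure (MulAction.orbit G x)
  smul_mem' g _ hy := smul_closure_orbit_subset g x (Set.smul_mem_smul_set hy)

/-! ### Periodic parts, skeletons and holes -/

/-- The `H`-periodic part of `x`: the positions `g` such that `x_{h⁻¹ g} = x_g` for all `h ∈ H`. -/
def periodicPart {G : Type u} [Group G] {A : Type v} (H : Subgroup G) (x : G → A) : Set G :=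
  {g | ∀ h ∈ H, x (h⁻¹ * g) = x g}

open Classical in
/-- The `H`-skeleton of `x`: equal to `x` on the `H`-periodic part, and to the additional symbol
`*` (here `none`) elsewhere. -/
def skeleton {G : Type u} [Group G] {A : Type v} (H : Subgroup G) (x : G → A) : G → Option A :=
  fun g => if g ∈ periodicPart H x then some (x g) else none

/-- The `H`-holes of `x`: the cosets of `H` on which the `H`-skeleton is constantly `*`. -/
def holes {G : Type u} [Group G] {A : Type v} (H : Subgroup G) (x : G → A) : Set (G ⧸ H) :=
  {c | ∀ g : G, (g : G ⧸ H) = c → skeleton H x g = none}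

/-- `x` is a Toeplitz element with respect to `(H_n)`: `G = ⋃ n, Per_{H_n}(x)`. -/
def IsToeplitz {G : Type u} [Group G] {A : Type v} (H : ℕ → Subgroup G) (x : G → A) : Prop :=
  ⋃ n, periodicPart (H n) x = Set.univ

/-! ### Sofic approximations -/

/-- A sequence of maps `σ n : G → Sym (V n)`, with `V n` finite, is a sofic approximation of `G` if
it is asymptotically multiplicative and asymptotically free. -/
structure IsSoficApproximation {G : Type u} [Group G] {V : ℕ → Type v}
    (σ : ∀ n, G → Equiv.Perm (V n)) : Prop where
  finite : ∀ n, Finite (V n)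
  multiplicative : ∀ s t : G, Tendsto
    (fun n => (Set.ncard {v | σ n (s * t) v = σ n s (σ n t v)} : ℝ) / Nat.card (V n)) atTop (𝓝 1)
  free : ∀ s t : G, s ≠ t → Tendsto
    (fun n => (Set.ncard {v | σ n t v ≠ σ n s v} : ℝ) / Nat.card (V n)) atTop (𝓝 1)

/-- The action on cosets `σ_g (c H) = c g⁻¹ H` for normal `H`. -/
def cosetPerm {G : Type u} [Group G] (H : Subgroup G) [H.Normal] (g : G) : Equiv.Perm (G ⧸ H) :=
  Equiv.mulRight ((g⁻¹ : G) : G ⧸ H)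

theorem cosetPerm_mk {G : Type u} [Group G] (H : Subgroup G) [H.Normal] (g c : G) :
    cosetPerm H g (c : G ⧸ H) = ((c * g⁻¹ : G) : G ⧸ H) := rfl

/-! ### Sofic topological entropy -/

/-- `d₂(φ, ψ) = (|V|⁻¹ ∑_v d(φ v, ψ v)²)^{1/2}`, for finite `V`. -/
def dTwo {X : Type u} {V : Type v} (d : PseudoMetric X ℝ) (φ ψ : V → X) : ℝ :=
  Real.sqrt ((∑ᶠ v, d (φ v) (ψ v) ^ 2) / Nat.card V)

/-- `d_∞(φ, ψ) = max_v d(φ v, ψ v)`, for finite `V`. -/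
def dInfty {X : Type u} {V : Type v} (d : PseudoMetric X ℝ) (φ ψ : V → X) : ℝ :=
  ⨆ v, d (φ v) (ψ v)

/-- `Map(d, F, δ, σ)`: the maps `φ : V → X` with `d₂(φ ∘ σ_s, s φ) ≤ δ` for all `s ∈ F`. -/
def soficMap {G : Type u} {X : Type v} {V : Type w} [SMul G X] (d : PseudoMetric X ℝ)
    (F : Finset G) (δ : ℝ) (σ : G → Equiv.Perm V) : Set (V → X) :=
  {φ | ∀ s ∈ F, dTwo d (fun v => φ (σ s v)) (fun v => s • φ v) ≤ δ}

/-- `N_ε(Y, ρ)`: the maximal cardinality of a subset `E` of `Y` with `ρ y z > ε` for all distinct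
`y, z ∈ E`. -/
def sepNumber {Z : Type u} (ε : ℝ) (Y : Set Z) (ρ : Z → Z → ℝ) : ℕ∞ :=
  ⨆ (E : Set Z) (_ : E ⊆ Y ∧ ∀ y ∈ E, ∀ z ∈ E, y ≠ z → ε < ρ y z), E.encard

/-- `h_Σ(d)`, with values in the extended reals. Here `log 0 = ⊥`, so the value is `⊥` as soon as
some `Map(d, F, δ, σ_n)` is empty for all large `n`. -/
def entropyOf {G : Type u} {X : Type v} [SMul G X] {V : ℕ → Type w}
    (σ : ∀ n, G → Equiv.Perm (V n)) (d : PseudoMetric X ℝ) : EReal :=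
  ⨆ (ε : ℝ) (_ : 0 < ε), ⨅ (F : Finset G), ⨅ (δ : ℝ) (_ : 0 < δ),
    limsup (fun n => ENNReal.log ((sepNumber ε (soficMap d F δ (σ n)) (dInfty d) : ℕ∞) : ENNReal) /
      (Nat.card (V n) : EReal)) atTop

/-- A pseudometric on `X` is continuous and dynamically generating for the action of `G`: distinct
points are separated by `d` after translating by some `s ∈ G`. -/
structure IsGenerating (G : Type u) {X : Type v} [TopologicalSpace X] [SMul G X]
    (d : PseudoMetric X ℝ) : Prop where
  continuous : Continuous fun p : X × X => d p.1 p.2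
  generating : ∀ x y : X, x ≠ y → ∃ s : G, 0 < d (s • x) (s • y)

/-- The sofic topological entropy of the system `(X, G)` with respect to `Σ` is `η`: `η` is the
common value of `h_Σ(d)` over all dynamically generating continuous pseudometrics `d` on `X` (and
such pseudometrics exist). -/
def HasSoficEntropy {G : Type u} {V : ℕ → Type w} (σ : ∀ n, G → Equiv.Perm (V n))
    (X : Type v) [TopologicalSpace X] [SMul G X] (η : EReal) : Prop :=
  (∃ d : PseudoMetric X ℝ, IsGenerating G d) ∧
    ∀ d : PseudoMetric X ℝ, IsGenerating G d → entropyOf σ d = η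

end ToeplitzSofic

end

namespace ToeplitzSofic

/-! ### Counting cosets -/

/-! The element comes from a tower of holes: sets of `a n` cosets of `H n`, decreasing with n, which
every group element eventually leaves. The strict inequality on `a` leaves a spare coset at each
stage, so the elements of an enumeration of G can be expelled one at a time. The letter at g depends
only on the coset of g at the level where g leaves the holes; hence x is constant on every coset off
the holes, and is Toeplitz.

The letters are chosen generically. By Baire's theorem on the product of the finite spaces `Filling
H k n`, every pattern for which the tower leaves room (the `Good` windows) occurs:
`exists_filling_patterns`. A hole with no surviving descendants at some finer level escapes this
argument, and there the non-constancy built into `Filling` makes x vary. So the cosets on which x is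
non-constant are exactly the holes of the tower.

Lower bound: the densities a n / [G : H n] decrease to θ, so for a fixed window all but o([G : H n])
cosets are good (`ncard_not_good_le`). There the holes can be recoloured at will and the local views
realised in the orbit of x, which gives k^(a n - o([G : H n])) separated, almost equivariant maps
(`lower_bound`).

Upper bound: fix m with a m / [G : H m] close to θ. Up to a sparse record of defects, an almost
equivariant map on G / H n is determined by its patterns over a transversal of H m, read at the [H m
: H n] cosets inside H m. Periodicity off the holes allows at most [G : H m] k^(a m) such patterns
(`upper_bound`). -/

theorem mk_eq_of_le {G : Type u} [Group G] {K L : Subgroup G} (h : K ≤ L) {g g' : G}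
    (hg : (g : G ⧸ K) = g') : (g : G ⧸ L) = g' := by
  rw [QuotientGroup.eq] at hg ⊢
  exact h hg

theorem ncard_preimage_quotientMapOfLE {G : Type u} [Group G] {K L : Subgroup G}
    (h : K ≤ L) (S : Set (G ⧸ L)) :
    (Subgroup.quotientMapOfLE h ⁻¹' S).ncard = S.ncard * K.relIndex L := by
  have key : (Subgroup.quotientEquivProdOfLE h) ⁻¹' (S ×ˢ Set.univ) =
      Subgroup.quotientMapOfLE h ⁻¹' S := by
    ext c
    induction c using QuotientGroup.induction_on with
    | H g => simp [Subgroup.quotientEquivProdOfLE, Subgroup.quotientEquivProdOfLE']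
  rw [← key, Set.ncard_preimage_of_injective_subset_range (Equiv.injective _) (by simp),
    Set.ncard_prod, Set.ncard_univ]
  rfl

/-- The strict inequality makes room for discarding the coset of `e`, which costs at most one
element. -/
theorem exists_hole_step {G : Type u} [Group G] {K L : Subgroup G} [K.FiniteIndex]
    (h : K ≤ L) (S : Set (G ⧸ L)) (b : ℕ) (hb : b < S.ncard * K.relIndex L) (e : G) :
    ∃ T : Set (G ⧸ K), T.ncard = b ∧ (e : G ⧸ K) ∉ T ∧
      ∀ g : G, (g : G ⧸ K) ∈ T → (g : G ⧸ L) ∈ S := by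
  rw [← ncard_preimage_quotientMapOfLE h] at hb
  have h1 := Set.pred_ncard_le_ncard_sdiff_singleton
    (Subgroup.quotientMapOfLE h ⁻¹' S) (e : G ⧸ K)
  obtain ⟨T, hT, hc⟩ := Set.exists_subset_card_eq
    (s := (Subgroup.quotientMapOfLE h ⁻¹' S) \ {(e : G ⧸ K)}) (n := b) (by omega)
  exact ⟨T, hc, fun he => (hT he).2 rfl, fun g hg => (hT hg).1⟩

/-! ### Towers of holes -/

/-- A decreasing sequence of sets of cosets, with `a n` cosets of `H n`, such that every element of
the group eventually leaves them. -/
structure HoleTower {G : Type u} [Group G] (H : ℕ → Subgroup G) (a : ℕ → ℕ) where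
  hole : ∀ n, Set (G ⧸ H n)
  ncard_hole : ∀ n, (hole n).ncard = a n
  of_succ : ∀ n (g : G), (g : G ⧸ H (n + 1)) ∈ hole (n + 1) → (g : G ⧸ H n) ∈ hole n
  exists_notMem : ∀ g : G, ∃ n, (g : G ⧸ H n) ∉ hole n

/-- Along an enumeration of G, the element numbered n is expelled at stage n + 1. -/
theorem exists_holeTower {G : Type u} [Group G] [Countable G] (H : ℕ → Subgroup G)
    [∀ n, (H n).FiniteIndex] (hH : Antitone H) (a : ℕ → ℕ) (ha_zero : a 0 ≤ (H 0).index)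
    (ha : ∀ n, a (n + 1) < a n * (H (n + 1)).relIndex (H n)) : Nonempty (HoleTower H a) := by
  obtain ⟨e, he⟩ := exists_surjective_nat G
  obtain ⟨S0, -, hS0⟩ := Set.exists_subset_card_eq (s := (Set.univ : Set (G ⧸ H 0))) (n := a 0)
    (by rw [Set.ncard_univ]; exact ha_zero)
  have step : ∀ n (S : {S : Set (G ⧸ H n) // S.ncard = a n}),
      ∃ T : {T : Set (G ⧸ H (n + 1)) // T.ncard = a (n + 1)}, (e n : G ⧸ H (n + 1)) ∉ T.1 ∧
        ∀ g : G, (g : G ⧸ H (n + 1)) ∈ T.1 → (g : G ⧸ H n) ∈ S.1 := by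
    intro n S
    obtain ⟨T, h1, h2, h3⟩ := exists_hole_step (hH n.le_succ) S.1 (a (n + 1))
      (by rw [S.2]; exact ha n) (e n)
    exact ⟨⟨T, h1⟩, h2, h3⟩
  choose f hf1 hf2 using step
  let A : ∀ n, {S : Set (G ⧸ H n) // S.ncard = a n} := fun n => Nat.rec ⟨S0, hS0⟩ f n
  refine ⟨⟨fun n => (A n).1, fun n => (A n).2, fun n g hg => hf2 n (A n) g hg, fun g => ?_⟩⟩
  obtain ⟨n, rfl⟩ := he g
  exact ⟨n + 1, hf1 n (A n)⟩

namespace HoleTower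

variable {G : Type u} [Group G] {H : ℕ → Subgroup G} {a : ℕ → ℕ} (A : HoleTower H a)

theorem of_le {n m : ℕ} (h : n ≤ m) {g : G} (hg : (g : G ⧸ H m) ∈ A.hole m) :
    (g : G ⧸ H n) ∈ A.hole n := by
  induction m, h using Nat.le_induction with
  | base => exact hg
  | succ m _ ih => exact ih (A.of_succ m g hg)

open Classical in
/-- The first index at which `g` is no longer in a hole. -/
noncomputable def level (g : G) : ℕ := Nat.find (A.exists_notMem g)

theorem level_le_iff {g : G} {n : ℕ} : A.level g ≤ n ↔ (g : G ⧸ H n) ∉ A.hole n := by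
  classical
  constructor
  · intro h hg
    exact Nat.find_spec (A.exists_notMem g) (A.of_le h hg)
  · intro h
    exact Nat.find_min' _ h

theorem lt_level_iff {g : G} {n : ℕ} : n < A.level g ↔ (g : G ⧸ H n) ∈ A.hole n := by
  rw [← not_le, level_le_iff, not_not]

theorem level_congr (hH : Antitone H) {n : ℕ} {g g' : G} (hg : (g : G ⧸ H n) = g')
    (h : A.level g ≤ n) : A.level g' = A.level g := by
  apply le_antisymm
  · rw [level_le_iff, ← mk_eq_of_le (hH h) hg, ← level_le_iff]
  · have h' : A.level g' ≤ n := by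
      rw [level_le_iff, ← hg, ← level_le_iff]; exact h
    rw [level_le_iff, mk_eq_of_le (hH h') hg, ← level_le_iff]

/-- The window `W` at `g₀ H_n` is good if over every finer level there is a translate of `W` whose
points in the holes of level `n` are still in holes. -/
def Good (n : ℕ) (W : Finset G) (g₀ : G) : Prop :=
  ∀ m, n ≤ m → ∃ g : G, (g : G ⧸ H n) = g₀ ∧
    ∀ f ∈ W, ((g * f : G) : G ⧸ H n) ∈ A.hole n → ((g * f : G) : G ⧸ H m) ∈ A.hole m

theorem Good.congr {A : HoleTower H a} {n : ℕ} {W : Finset G} {g g' : G}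
    (hg : (g : G ⧸ H n) = g') (h : A.Good n W g) : A.Good n W g' := by
  unfold Good at h ⊢
  rwa [← hg]

/-- Every lift of a bad coset to level m is carried by right multiplication by some f in W into D,
the level-m cosets lost from the holes between n and m. Right multiplication is injective on the
quotient, and |D| = a n [H n : H m] - a m, so dividing by the relative index gives the bound. -/
theorem ncard_bad_le [∀ n, (H n).Normal] [∀ n, (H n).FiniteIndex] (hH : Antitone H)
    {n m : ℕ} (hnm : n ≤ m) (W : Finset G) :
    ({c : G ⧸ H n | ∀ g : G, (g : G ⧸ H n) = c → ∃ f ∈ W,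
      ((g * f : G) : G ⧸ H n) ∈ A.hole n ∧ ((g * f : G) : G ⧸ H m) ∉ A.hole m}.ncard : ℝ) ≤
    W.card * (a n - a m / (H m).index * (H n).index) := by
  set B := {c : G ⧸ H n | ∀ g : G, (g : G ⧸ H n) = c → ∃ f ∈ W,
      ((g * f : G) : G ⧸ H n) ∈ A.hole n ∧ ((g * f : G) : G ⧸ H m) ∉ A.hole m}
  set π := Subgroup.quotientMapOfLE (hH hnm)
  set D : Set (G ⧸ H m) := π ⁻¹' (A.hole n) \ A.hole m
  have hsub : A.hole m ⊆ π ⁻¹' (A.hole n) := by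
    intro c hc
    induction c using QuotientGroup.induction_on with
    | H g => exact A.of_le hnm hc
  have hD : D.ncard + a m = a n * (H m).relIndex (H n) := by
    have := Set.ncard_sdiff_add_ncard_of_subset hsub (Set.toFinite _)
    rwa [ncard_preimage_quotientMapOfLE, A.ncard_hole, A.ncard_hole] at this
  have hB : π ⁻¹' B ⊆ ⋃ f ∈ W, (fun c => c * (f : G ⧸ H m)) ⁻¹' D := by
    intro c hc
    induction c using QuotientGroup.induction_on with
    | H g =>
      obtain ⟨f, hf, h1, h2⟩ := hc g rfl
      simp only [Set.mem_iUnion]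
      exact ⟨f, hf, h1, h2⟩
  have hB' : B.ncard * (H m).relIndex (H n) ≤ W.card * D.ncard := by
    rw [← ncard_preimage_quotientMapOfLE (hH hnm)]
    refine (Set.ncard_le_ncard hB (Set.toFinite _)).trans ?_
    refine (Finset.set_ncard_biUnion_le _ _).trans ?_
    rw [← smul_eq_mul]
    refine Finset.sum_le_card_nsmul _ _ _ fun f _ => ?_
    rw [Set.ncard_preimage_of_injective_subset_range (mul_left_injective _)
      (fun c _ => ⟨c * (f : G ⧸ H m)⁻¹, by simp⟩)]
  have hr : (H m).relIndex (H n) * (H n).index = (H m).index :=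
    Subgroup.relIndex_mul_index (hH hnm)
  have hi : 0 < ((H m).index : ℝ) := by
    exact_mod_cast Nat.pos_of_ne_zero Subgroup.FiniteIndex.index_ne_zero
  have hi' : 0 < ((H n).index : ℝ) := by
    exact_mod_cast Nat.pos_of_ne_zero Subgroup.FiniteIndex.index_ne_zero
  have hrR : ((H m).relIndex (H n) : ℝ) * (H n).index = (H m).index := by exact_mod_cast hr
  have hr0 : 0 < ((H m).relIndex (H n) : ℝ) := by
    by_contra hcon
    nlinarith
  have hDR : (D.ncard : ℝ) + a m = a n * (H m).relIndex (H n) := by exact_mod_cast hD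
  have hBR : (B.ncard : ℝ) * (H m).relIndex (H n) ≤ W.card * D.ncard := by exact_mod_cast hB'
  have e1 : (a m : ℝ) / (H m).index * (H n).index = a m / (H m).relIndex (H n) := by
    rw [← hrR]; field_simp
  rw [e1, ← mul_le_mul_iff_of_pos_right hr0]
  refine hBR.trans (le_of_eq ?_)
  rw [eq_sub_of_add_eq hDR]
  field_simp

theorem density_antitone [∀ n, (H n).FiniteIndex] (hH : Antitone H)
    (ha : ∀ n, a (n + 1) < a n * (H (n + 1)).relIndex (H n)) :
    Antitone fun n => (a n : ℝ) / (H n).index := by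
  refine antitone_nat_of_succ_le fun n => ?_
  have hi : 0 < ((H n).index : ℝ) := by
    exact_mod_cast Nat.pos_of_ne_zero Subgroup.FiniteIndex.index_ne_zero
  have hi' : 0 < ((H (n + 1)).index : ℝ) := by
    exact_mod_cast Nat.pos_of_ne_zero Subgroup.FiniteIndex.index_ne_zero
  have hr : ((H (n + 1)).relIndex (H n) : ℝ) * (H n).index = (H (n + 1)).index := by
    exact_mod_cast Subgroup.relIndex_mul_index (hH n.le_succ)
  have h1 : (a (n + 1) : ℝ) ≤ a n * (H (n + 1)).relIndex (H n) := by exact_mod_cast (ha n).le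
  rw [div_le_div_iff₀ hi' hi, ← hr]
  nlinarith

/-- The level m witnessing failure depends on the coset, but there are finitely many cosets and
failure persists to finer levels, so one m serves them all in `ncard_bad_le`. -/
theorem ncard_not_good_le [∀ n, (H n).Normal] [∀ n, (H n).FiniteIndex] (hH : Antitone H)
    (ha : ∀ n, a (n + 1) < a n * (H (n + 1)).relIndex (H n)) {θ : ℝ}
    (hθ : Tendsto (fun n => (a n : ℝ) / (H n).index) atTop (𝓝 θ)) (n : ℕ) (W : Finset G) :
    ({c : G ⧸ H n | ∃ g : G, (g : G ⧸ H n) = c ∧ ¬ A.Good n W g}.ncard : ℝ) ≤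
      W.card * (a n - θ * (H n).index) := by
  set B := {c : G ⧸ H n | ∃ g : G, (g : G ⧸ H n) = c ∧ ¬ A.Good n W g}
  have hB : ∀ c ∈ B, ∃ m, n ≤ m ∧ ∀ g : G, (g : G ⧸ H n) = c → ∃ f ∈ W,
      ((g * f : G) : G ⧸ H n) ∈ A.hole n ∧ ((g * f : G) : G ⧸ H m) ∉ A.hole m := by
    rintro _ ⟨g, rfl, hg⟩
    unfold Good at hg
    push Not at hg
    exact hg
  choose! M hM1 hM2 using hB
  obtain ⟨m, hm⟩ := ((Set.toFinite B).image M).bddAbove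
  have hle : B.ncard ≤ _ := Set.ncard_le_ncard (t := {c : G ⧸ H n | ∀ g : G, (g : G ⧸ H n) = c →
      ∃ f ∈ W, ((g * f : G) : G ⧸ H n) ∈ A.hole n ∧
        ((g * f : G) : G ⧸ H (max n m)) ∉ A.hole (max n m)}) (fun c hc g hg => by
    obtain ⟨f, hf, h1, h2⟩ := hM2 c hc g hg
    exact ⟨f, hf, h1, fun h => h2 (A.of_le
      ((hm ⟨c, hc, rfl⟩).trans (le_max_right _ _)) h)⟩) (Set.toFinite _)
  have := A.ncard_bad_le hH (le_max_left n m) W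
  have hθle := (density_antitone hH ha).le_of_tendsto hθ (max n m)
  have hi : (0 : ℝ) ≤ (H n).index := by positivity
  calc (B.ncard : ℝ) ≤ _ := by exact_mod_cast hle
    _ ≤ _ := this
    _ ≤ _ := by gcongr

end HoleTower

/-! ### Generic fillings -/

/-- The colourings of `G ⧸ H n` that are non-constant on every coset of `H (n - 1)`. -/
def Filling {G : Type u} [Group G] (H : ℕ → Subgroup G) (k n : ℕ) : Type u :=
  {w : G ⧸ H n → Fin k // ∀ m, n = m + 1 → ∀ g : G, ∃ g₁ g₂ : G,
    (g₁ : G ⧸ H m) = g ∧ (g₂ : G ⧸ H m) = g ∧ w g₁ ≠ w g₂}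

instance {G : Type u} [Group G] (H : ℕ → Subgroup G) (k n : ℕ) :
    TopologicalSpace (Filling H k n) := ⊥

instance {G : Type u} [Group G] (H : ℕ → Subgroup G) (k n : ℕ) :
    DiscreteTopology (Filling H k n) := ⟨rfl⟩

instance {G : Type u} [Group G] (H : ℕ → Subgroup G) [∀ n, (H n).FiniteIndex] (k n : ℕ) :
    Finite (Filling H k n) := Subtype.finite

theorem exists_sibling {G : Type u} [Group G] {H : ℕ → Subgroup G} (hH : StrictAnti H) (n : ℕ)
    (g : G) : ∃ g' : G, (g' : G ⧸ H n) = g ∧ (g' : G ⧸ H (n + 1)) ≠ g := by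
  obtain ⟨h, h1, h2⟩ := SetLike.exists_of_lt (hH n.lt_succ_self)
  refine ⟨g * h, ?_, ?_⟩
  · rw [eq_comm, QuotientGroup.eq]
    simpa using h1
  · rw [ne_comm, Ne, QuotientGroup.eq]
    simpa using h2

theorem nonempty_filling {G : Type u} [Group G] {H : ℕ → Subgroup G} (hH : StrictAnti H) {k : ℕ}
    (hk : 1 < k) (n : ℕ) : Nonempty (Filling H k n) := by
  classical
  cases n with
  | zero => exact ⟨⟨fun _ => ⟨0, by omega⟩, fun m hm => by omega⟩⟩
  | succ n =>
    -- Exactly one child of each coset of `H n` gets colour 0; it has siblings because the sequence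
    -- is strictly decreasing.
    refine ⟨⟨fun c => if ∃ q : G ⧸ H n, c = (q.out : G ⧸ H (n + 1)) then ⟨0, by omega⟩
      else ⟨1, hk⟩, ?_⟩⟩
    rintro m hm g
    obtain rfl : n = m := by omega
    set r : G := (g : G ⧸ H n).out
    have hr : (r : G ⧸ H n) = g := Quotient.out_eq' (g : G ⧸ H n)
    obtain ⟨g', h1, h2⟩ := exists_sibling hH n r
    refine ⟨r, g', hr, h1.trans hr, ?_⟩
    beta_reduce
    rw [if_pos ⟨(g : G ⧸ H n), rfl⟩, if_neg]
    · simp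
    · rintro ⟨q, hq⟩
      have := mk_eq_of_le (hH n.lt_succ_self).le hq
      have hq' : ((q.out : G) : G ⧸ H n) = q := Quotient.out_eq' q
      rw [hq', h1, hr] at this
      subst this
      exact h2 hq

namespace HoleTower

variable {G : Type u} [Group G] {H : ℕ → Subgroup G} {a : ℕ → ℕ} (A : HoleTower H a)

/-- The configuration with values prescribed by colourings of the coset spaces: the value at `g` is
the colour of its coset at the level at which `g` leaves the holes. -/
noncomputable def config {k : ℕ} (v : ∀ n, Filling H k n) : FullShift k G :=
  fun g => (v (A.level g)).1 g

/-- The pattern `p` on the holes in the window `W` at `g₀ H_n` occurs, if that window is good. -/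
def patternSet {k : ℕ} (n : ℕ) (W : Finset G) (g₀ : G) (p : W → Fin k) :
    Set (∀ n, Filling H k n) :=
  {v | A.Good n W g₀ → ∃ g : G, (g : G ⧸ H n) = g₀ ∧ ∀ f : W,
    ((g * f : G) : G ⧸ H n) ∈ A.hole n → A.config v (g * f) = p f}

/-- The value of `config` at a given point depends on a single coordinate of `v`. -/
theorem isOpen_patternSet {k : ℕ} (n : ℕ) (W : Finset G) (g₀ : G) (p : W → Fin k) :
    IsOpen (A.patternSet n W g₀ p) := by
  by_cases hg : A.Good n W g₀
  · have : A.patternSet n W g₀ p = ⋃ g : G, ⋃ _ : (g : G ⧸ H n) = g₀, ⋂ f : W,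
        {v | ((g * f : G) : G ⧸ H n) ∈ A.hole n → A.config v (g * f) = p f} := by
      ext v
      simp [patternSet, hg]
    rw [this]
    refine isOpen_iUnion fun g => isOpen_iUnion fun _ => isOpen_iInter_of_finite fun f => ?_
    let s : Set (Filling H k (A.level (g * f))) :=
      {w | ((g * f : G) : G ⧸ H n) ∈ A.hole n → w.1 (g * f : G) = p f}
    exact (isOpen_discrete s).preimage (continuous_apply (A.level (g * f)))
  · have : A.patternSet n W g₀ p = Set.univ := by
      ext v
      simp [patternSet, hg]
    rw [this]
    exact isOpen_univ

theorem exists_separating (hH : StrictAnti H) (hbot : ⨅ n, H n = ⊥) (W : Finset G) :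
    ∃ N, ∀ m, N ≤ m → ∀ f ∈ W, ∀ f' ∈ W, (f : G ⧸ H m) = f' → f = f' := by
  have h1 : ∀ q : G × G, ∃ N, q.1 ≠ q.2 → ∀ m, N ≤ m → (q.1 : G ⧸ H m) ≠ q.2 := by
    intro q
    by_cases hq : q.1 = q.2
    · exact ⟨0, fun h => absurd hq h⟩
    · have : q.1⁻¹ * q.2 ∉ ⨅ n, H n := by
        rw [hbot, Subgroup.mem_bot, inv_mul_eq_one]
        exact hq
      rw [Subgroup.mem_iInf] at this
      push Not at this
      obtain ⟨N, hN⟩ := this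
      refine ⟨N, fun _ m hm h => hN ?_⟩
      rw [QuotientGroup.eq] at h
      exact hH.antitone hm h
  choose N hN using h1
  refine ⟨(W ×ˢ W).sup N, fun m hm f hf f' hf' h => ?_⟩
  by_contra hne
  exact hN (f, f') hne m
    ((Finset.le_sup (f := N) (Finset.mk_mem_product hf hf')).trans hm) h

/-- Recolouring above level `m` so that a prescribed window carries a prescribed pattern. -/
theorem exists_recolouring [∀ n, (H n).Normal] (hH : StrictAnti H) {k : ℕ} (hk : 1 < k)
    (v : ∀ n, Filling H k n) (W : Finset G) (p : W → Fin k) (m : ℕ)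
    (hm : ∀ f ∈ W, ∀ f' ∈ W, (f : G ⧸ H m) = f' → f = f') (g : G) :
    ∃ v' : ∀ n, Filling H k n, (∀ l ≤ m, v' l = v l) ∧
      ∀ f : W, m < A.level (g * f) → A.config v' (g * f) = p f := by
  classical
  have hm' : ∀ l, m ≤ l → ∀ f f' : W, ((g * f : G) : G ⧸ H l) = (g * f' : G) → f = f' := by
    intro l hl f f' h
    refine Subtype.ext (hm f f.2 f' f'.2 ?_)
    have := mk_eq_of_le (hH.antitone hl) h
    simpa using this
  have other : ∀ i : Fin k, ∃ j, j ≠ i := by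
    have : Nontrivial (Fin k) := Fin.nontrivial_iff_two_le.2 hk
    exact fun i => exists_ne i
  choose o ho using other
  have key : ∀ l, ∃ w : Filling H k (l + 1), ∀ f : W, m ≤ l → A.level (g * f) = l + 1 →
      w.1 (g * f : G) = p f := by
    intro l
    by_cases hl : m ≤ l
    swap
    · exact ⟨v (l + 1), fun f h => absurd h hl⟩
    -- P selects the `H l`-cosets containing a window point of level l + 1. Such a point is unique,
    -- since W is separated modulo `H l`; it gets the prescribed letter and its siblings a different
    -- one, so the colouring stays non-constant on that coset.
    let P : G ⧸ H (l + 1) → Prop := fun c => ∃ f : W, A.level (g * f) = l + 1 ∧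
      Subgroup.quotientMapOfLE (hH.antitone l.le_succ) c = (g * f : G)
    let w : G ⧸ H (l + 1) → Fin k := fun c =>
      if h : P c then
        if c = (g * h.choose : G) then p h.choose else o (p h.choose)
      else (v (l + 1)).1 c
    have hw : ∀ f : W, A.level (g * f) = l + 1 → ∀ g' : G, (g' : G ⧸ H l) = (g * f : G) →
        w g' = if (g' : G ⧸ H (l + 1)) = (g * f : G) then p f else o (p f) := by
      intro f hf g' hg'
      have h : P g' := ⟨f, hf, hg'⟩
      have hc : h.choose = f := hm' l hl _ _ (h.choose_spec.2.symm.trans hg')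
      simp only [w, dif_pos h, hc]
    refine ⟨⟨w, ?_⟩, fun f _ hf => ?_⟩
    · intro m' hm' g'
      obtain rfl : l = m' := by omega
      by_cases h : P g'
      · obtain ⟨f, hf, hg'⟩ := h
        obtain ⟨g'', h1, h2⟩ := exists_sibling hH l (g * f)
        refine ⟨g * f, g'', hg'.symm, h1.trans hg'.symm, ?_⟩
        rw [hw f hf _ rfl, hw f hf _ h1, if_pos rfl, if_neg h2]
        exact (ho _).symm
      · obtain ⟨g₁, g₂, h1, h2, h3⟩ := (v (l + 1)).2 l rfl g'
        refine ⟨g₁, g₂, h1, h2, ?_⟩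
        have e : ∀ g₁ : G, (g₁ : G ⧸ H l) = g' → w g₁ = (v (l + 1)).1 g₁ := by
          intro g₁ h1
          have : ¬ P g₁ := by
            rintro ⟨f, hf, hf'⟩
            exact h ⟨f, hf, h1.symm.trans hf'⟩
          simp only [w, dif_neg this]
        rwa [e _ h1, e _ h2]
    · change w _ = _
      rw [hw f hf _ rfl, if_pos rfl]
  choose w hw using key
  let v' : ∀ n, Filling H k n := fun n => match n with
    | 0 => v 0
    | l + 1 => if m ≤ l then w l else v (l + 1)
  refine ⟨v', ?_, ?_⟩
  · rintro (_ | l) hl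
    · rfl
    · exact if_neg (by omega)
  · intro f hf
    obtain ⟨l, hl⟩ : ∃ l, A.level (g * f) = l + 1 := ⟨A.level (g * f) - 1, by omega⟩
    have e : v' (l + 1) = w l := if_pos (by omega)
    have := hw l f (by omega) hl
    rw [← e] at this
    unfold config
    rw [hl]
    exact this

/-- A basic open set constrains finitely many coordinates. Goodness supplies a translate whose
relevant points are still in holes beyond all of them, so their letters are free. -/
theorem dense_patternSet [∀ n, (H n).Normal] (hH : StrictAnti H) (hbot : ⨅ n, H n = ⊥) {k : ℕ}
    (hk : 1 < k) (n : ℕ) (W : Finset G) (g₀ : G) (p : W → Fin k) :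
    Dense (A.patternSet n W g₀ p) := by
  rw [dense_iff_inter_open]
  rintro U hU ⟨v, hv⟩
  obtain ⟨I, s, hs, hsU⟩ := isOpen_pi_iff.1 hU v hv
  by_cases hg : A.Good n W g₀
  swap
  · exact ⟨v, hv, fun h => absurd h hg⟩
  obtain ⟨N, hN⟩ := exists_separating hH hbot W
  set m := max N (max n (I.sup id))
  obtain ⟨g, hg1, hg2⟩ := hg m ((le_max_left _ _).trans (le_max_right _ _))
  obtain ⟨v', h1, h2⟩ := A.exists_recolouring hH hk v W p m (hN m (le_max_left _ _)) g
  refine ⟨v', hsU fun i hi => ?_, fun _ => ⟨g, hg1, fun f hf => h2 f ?_⟩⟩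
  · rw [h1 i ((Finset.le_sup (f := id) hi).trans ((le_max_right _ _).trans (le_max_right _ _)))]
    exact (hs i hi).2
  · rw [lt_level_iff]
    exact hg2 f f.2 hf

/-- Baire category: windows, levels, base points and patterns form a countable family of dense open
conditions. -/
theorem exists_filling_patterns [Countable G] [∀ n, (H n).Normal] [∀ n, (H n).FiniteIndex]
    (hH : StrictAnti H) (hbot : ⨅ n, H n = ⊥) {k : ℕ} (hk : 1 < k) :
    ∃ v : ∀ n, Filling H k n, ∀ n (W : Finset G) (g₀ : G), A.Good n W g₀ →
      ∀ p : G → Fin k, ∃ g : G, (g : G ⧸ H n) = g₀ ∧ ∀ f ∈ W,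
        ((g * f : G) : G ⧸ H n) ∈ A.hole n → A.config v (g * f) = p f := by
  have : ∀ n, Nonempty (Filling H k n) := nonempty_filling hH hk
  have hd := dense_iInter_of_isOpen
    (f := fun t : Σ W : Finset G, ℕ × G × (W → Fin k) => A.patternSet t.2.1 t.1 t.2.2.1 t.2.2.2)
    (fun t => A.isOpen_patternSet _ _ _ _) (fun t => A.dense_patternSet hH hbot hk _ _ _ _)
  obtain ⟨v, hv⟩ := hd.nonempty
  refine ⟨v, fun n W g₀ hg p => ?_⟩
  obtain ⟨g, h1, h2⟩ := Set.mem_iInter.1 hv ⟨W, n, g₀, fun f => p f⟩ hg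
  exact ⟨g, h1, fun f hf => h2 ⟨f, hf⟩⟩

/-! ### Periodic parts and holes of the configuration -/

theorem config_congr {k : ℕ} (hH : StrictAnti H) (v : ∀ n, Filling H k n) {n : ℕ} {g g' : G}
    (hg : (g : G ⧸ H n) = g') (hn : (g : G ⧸ H n) ∉ A.hole n) :
    A.config v g' = A.config v g := by
  rw [← level_le_iff] at hn
  have h := A.level_congr hH.antitone hg hn
  unfold config
  rw [h, mk_eq_of_le (hH.antitone hn) hg]

theorem exists_config_ne {k : ℕ} (hH : StrictAnti H) (hk : 1 < k) {v : ∀ n, Filling H k n}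
    (hv : ∀ n (W : Finset G) (g₀ : G), A.Good n W g₀ →
      ∀ p : G → Fin k, ∃ g : G, (g : G ⧸ H n) = g₀ ∧ ∀ f ∈ W,
        ((g * f : G) : G ⧸ H n) ∈ A.hole n → A.config v (g * f) = p f)
    {n : ℕ} {g : G} (hg : (g : G ⧸ H n) ∈ A.hole n) :
    ∃ g₁ g₂ : G, (g₁ : G ⧸ H n) = g ∧ (g₂ : G ⧸ H n) = g ∧ A.config v g₁ ≠ A.config v g₂ := by
  classical
  -- Either all points of the coset have left the holes by some level, or some survive at every
  -- level. In the first case take the least such level l + 1: some subcoset at level l lies in the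
  -- holes, all its points have level l + 1, and the filling is non-constant on it.
  by_cases hex : ∃ m, n ≤ m ∧ ∀ g' : G, (g' : G ⧸ H n) = g → (g' : G ⧸ H m) ∉ A.hole m
  · set m := Nat.find hex
    obtain ⟨hm1, hm2⟩ : n ≤ m ∧ ∀ g' : G, (g' : G ⧸ H n) = g → (g' : G ⧸ H m) ∉ A.hole m :=
      Nat.find_spec hex
    have hnm : n ≠ m := fun h => by
      rw [← h] at hm2
      exact hm2 g rfl hg
    obtain ⟨l, hl⟩ : ∃ l, m = l + 1 := ⟨m - 1, by omega⟩
    have := Nat.find_min hex (m := l) (by omega)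
    push Not at this
    obtain ⟨g', h1, h2⟩ := this (by omega)
    obtain ⟨g₁, g₂, e1, e2, hne⟩ := (v (l + 1)).2 l rfl g'
    have hlev : ∀ g₁ : G, (g₁ : G ⧸ H l) = g' →
        (g₁ : G ⧸ H n) = g ∧ A.level g₁ = l + 1 := by
      intro g₁ e1
      have e : (g₁ : G ⧸ H n) = g := (mk_eq_of_le (hH.antitone (by omega)) e1).trans h1
      refine ⟨e, le_antisymm ?_ ?_⟩
      · rw [level_le_iff, ← hl]
        exact hm2 _ e
      · rw [Nat.succ_le_iff, lt_level_iff, e1]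
        exact h2
    refine ⟨g₁, g₂, (hlev _ e1).1, (hlev _ e2).1, ?_⟩
    unfold config
    rw [(hlev _ e1).2, (hlev _ e2).2]
    exact hne
  · push Not at hex
    -- Survival at every level makes the one-point window good, so every letter occurs on the coset.
    have hgood : A.Good n {1} g := by
      intro m hm
      obtain ⟨g', h1, h2⟩ := hex m hm
      refine ⟨g', h1, fun f hf _ => ?_⟩
      rw [Finset.mem_singleton.1 hf, mul_one]
      exact h2
    have hp : ∀ i : Fin k, ∃ g' : G, (g' : G ⧸ H n) = g ∧ A.config v g' = i := by
      intro i
      obtain ⟨g', h1, h2⟩ := hv n {1} g hgood (fun _ => i)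
      refine ⟨g', h1, ?_⟩
      have := h2 1 (by simp)
      rw [mul_one] at this
      exact this (h1 ▸ hg)
    obtain ⟨g₁, h1, h1'⟩ := hp ⟨0, by omega⟩
    obtain ⟨g₂, h2, h2'⟩ := hp ⟨1, hk⟩
    refine ⟨g₁, g₂, h1, h2, ?_⟩
    rw [h1', h2']
    simp

end HoleTower

/-- Periodicity is defined by left translation, that is on Kg; normality turns this into gK. -/
theorem mem_periodicPart_iff {G : Type u} [Group G] {K : Subgroup G} [K.Normal] {B : Type v}
    (x : G → B) (g : G) : g ∈ periodicPart K x ↔ ∀ g' : G, (g' : G ⧸ K) = g → x g' = x g := by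
  constructor
  · intro h g' hg'
    have : g * g'⁻¹ ∈ K := by
      rw [← QuotientGroup.eq_one_iff, QuotientGroup.mk_mul, QuotientGroup.mk_inv, hg',
        mul_inv_cancel]
    simpa using h _ this
  · intro h k hk
    refine h _ ?_
    rw [QuotientGroup.mk_mul, QuotientGroup.mk_inv, (QuotientGroup.eq_one_iff k).2 hk]
    simp

theorem periodicPart_eq_of_tower {G : Type u} [Group G] {K : Subgroup G} [K.Normal] {B : Type v}
    (x : G → B) (S : Set (G ⧸ K))
    (h1 : ∀ g g' : G, (g : G ⧸ K) = g' → (g : G ⧸ K) ∉ S → x g' = x g)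
    (h2 : ∀ g : G, (g : G ⧸ K) ∈ S → ∃ g₁ g₂ : G,
      (g₁ : G ⧸ K) = g ∧ (g₂ : G ⧸ K) = g ∧ x g₁ ≠ x g₂) :
    periodicPart K x = {g : G | (g : G ⧸ K) ∉ S} := by
  ext g
  rw [mem_periodicPart_iff]
  constructor
  · intro h hg
    obtain ⟨g₁, g₂, e1, e2, hne⟩ := h2 g hg
    exact hne ((h g₁ e1).trans (h g₂ e2).symm)
  · intro hg g' hg'
    exact h1 g g' hg'.symm hg

theorem holes_eq_of_periodicPart_eq {G : Type u} [Group G] {K : Subgroup G} {B : Type v}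
    (x : G → B) (S : Set (G ⧸ K)) (h : periodicPart K x = {g : G | (g : G ⧸ K) ∉ S}) :
    holes K x = S := by
  ext c
  induction c using QuotientGroup.induction_on with
  | H g =>
    have hs : ∀ g : G, skeleton K x g = none ↔ (g : G ⧸ K) ∈ S := by
      intro g
      simp [skeleton, h]
    simp only [holes, Set.mem_ofPred_eq, hs]
    exact ⟨fun h => h g rfl, fun h g' hg' => hg' ▸ h⟩

/-! ### Compactness of orbit closures -/

section Compactness

variable {G : Type u} [Group G] {k : ℕ} (x : FullShift k G)

instance : CompactSpace (FullShift k G) := inferInstanceAs (CompactSpace (G → Fin k))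

instance : CompactSpace (orbitClosure x) :=
  isCompact_iff_compactSpace.1
    (isClosed_closure : IsClosed (closure (MulAction.orbit G x))).isCompact

theorem continuous_coord (g : G) : Continuous fun y : orbitClosure x => y.1 g :=
  (continuous_apply (A := fun _ : G => Fin k) g).comp continuous_subtype_val

theorem coe_smul_apply (s : G) (y : orbitClosure x) (f : G) : (s • y).1 f = y.1 (s⁻¹ * f) := rfl

/-- The point `g⁻¹ x` of the orbit closure of `x`. -/
def orbitPoint (g : G) : orbitClosure x :=
  ⟨g⁻¹ • x, subset_closure (MulAction.mem_orbit x g⁻¹)⟩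

theorem orbitPoint_apply (g f : G) : (orbitPoint x g).1 f = x (g * f) := by
  change x (g⁻¹⁻¹ * f) = _
  rw [inv_inv]

theorem continuous_smul_orbitClosure (s : G) : Continuous fun y : orbitClosure x => s • y :=
  Continuous.subtype_mk ((continuous_const_smul s).comp continuous_subtype_val) _

variable {x} {d : PseudoMetric (orbitClosure x) ℝ}

/-- The pairs at distance at least ε form a compact set off the diagonal, covered by the open sets
on which some coordinate differs. -/
theorem IsGenerating.exists_window (hd : IsGenerating G d) {ε : ℝ} (hε : 0 < ε) :
    ∃ W : Finset G, ∀ y z : orbitClosure x, (∀ f ∈ W, y.1 f = z.1 f) → d y z < ε := by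
  have hC : IsCompact {p : orbitClosure x × orbitClosure x | ε ≤ d p.1 p.2} :=
    (isClosed_le continuous_const hd.continuous).isCompact
  obtain ⟨W, hW⟩ := hC.elim_finite_subcover
    (fun g : G => {p : orbitClosure x × orbitClosure x | p.1.1 g ≠ p.2.1 g})
    (fun g => isOpen_ne_fun ((continuous_coord x g).comp continuous_fst)
      ((continuous_coord x g).comp continuous_snd)) (by
      intro p hp
      have hne : p.1.1 ≠ p.2.1 := by
        intro h
        have : p.1 = p.2 := Subtype.ext h
        have hp' : ε ≤ d p.1 p.2 := hp
        rw [this, d.refl] at hp'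
        exact absurd hp' (not_le.2 hε)
      obtain ⟨g, hg⟩ := Function.ne_iff.1 hne
      exact Set.mem_iUnion.2 ⟨g, hg⟩)
  refine ⟨W, fun y z h => ?_⟩
  by_contra hcon
  have := hW (show (y, z) ∈ _ from not_lt.1 hcon)
  simp only [Set.mem_iUnion] at this
  obtain ⟨g, hg, hne⟩ := this
  exact hne (h g hg)

/-- The pairs differing at 1 form a clopen, hence compact, set; generation covers it by the open
conditions 1/(n+1) < d(sy, sz). -/
theorem IsGenerating.exists_separation (hd : IsGenerating G d) :
    ∃ (K : Finset G) (κ : ℝ), 0 < κ ∧ ∀ y z : orbitClosure x, y.1 1 ≠ z.1 1 →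
      ∃ s ∈ K, κ < d (s • y) (s • z) := by
  classical
  have hC : IsCompact {p : orbitClosure x × orbitClosure x | p.1.1 1 ≠ p.2.1 1} := by
    have : IsClopen {p : orbitClosure x × orbitClosure x | p.1.1 1 = p.2.1 1} := by
      have h := (isClopen_discrete {q : Fin k × Fin k | q.1 = q.2}).preimage
        (((continuous_coord x 1).comp continuous_fst).prodMk
          ((continuous_coord x 1).comp continuous_snd))
      exact h
    exact this.compl.1.isCompact
  obtain ⟨t, ht⟩ := hC.elim_finite_subcover
    (fun q : G × ℕ => {p : orbitClosure x × orbitClosure x |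
      1 / ((q.2 : ℝ) + 1) < d (q.1 • p.1) (q.1 • p.2)})
    (fun q => isOpen_lt continuous_const (hd.continuous.comp
      (((continuous_smul_orbitClosure x q.1).comp continuous_fst).prodMk
        ((continuous_smul_orbitClosure x q.1).comp continuous_snd)))) (by
      intro p hp
      have hne : p.1 ≠ p.2 := fun h => hp (by rw [h])
      obtain ⟨s, hs⟩ := hd.generating _ _ hne
      obtain ⟨n, hn⟩ := exists_nat_one_div_lt hs
      exact Set.mem_iUnion.2 ⟨(s, n), hn⟩)
  refine ⟨t.image Prod.fst, 1 / (((t.image Prod.snd).sup id : ℕ) + 1), by positivity,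
    fun y z h => ?_⟩
  have := ht (show (y, z) ∈ _ from h)
  simp only [Set.mem_iUnion] at this
  obtain ⟨q, hq, hlt⟩ := this
  refine ⟨q.1, Finset.mem_image_of_mem _ hq, lt_of_le_of_lt ?_ hlt⟩
  have : q.2 ≤ (t.image Prod.snd).sup id :=
    Finset.le_sup (f := id) (Finset.mem_image_of_mem Prod.snd hq)
  gcongr

theorem IsGenerating.exists_bound (hd : IsGenerating G d) :
    ∃ D : ℝ, ∀ y z : orbitClosure x, d y z ≤ D := by
  obtain ⟨D, hD⟩ := (isCompact_range hd.continuous).bddAbove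
  exact ⟨D, fun y z => hD ⟨(y, z), rfl⟩⟩

variable (x)

/-- The discrete metric of the coordinate at 1 is continuous, and the action moves any coordinate to
1. -/
theorem exists_isGenerating : ∃ d : PseudoMetric (orbitClosure x) ℝ, IsGenerating G d := by
  classical
  refine ⟨⟨fun y z => if y.1 1 = z.1 1 then 0 else 1, fun y => by simp,
    fun y z => by simp only [eq_comm], fun y z t => ?_⟩, ?_, ?_⟩
  · by_cases h1 : y.1 1 = z.1 1
    · simp [h1]
    · by_cases h2 : y.1 1 = t.1 1 <;> by_cases h3 : z.1 1 = t.1 1 <;>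
        simp [h1, h2, h3]
      split_ifs <;> norm_num
  · exact (continuous_of_discreteTopology
      (f := fun q : Fin k × Fin k => if q.1 = q.2 then (0 : ℝ) else 1)).comp
      (((continuous_coord x 1).comp continuous_fst).prodMk
        ((continuous_coord x 1).comp continuous_snd))
  · intro y z hne
    obtain ⟨g, hg⟩ := Function.ne_iff.1 (fun h => hne (Subtype.ext h) : y.1 ≠ z.1)
    refine ⟨g⁻¹, ?_⟩
    have : ¬ (g⁻¹ • y).1 1 = (g⁻¹ • z).1 1 := by
      rw [coe_smul_apply, coe_smul_apply]
      simpa using hg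
    change (0 : ℝ) < if (g⁻¹ • y).1 1 = (g⁻¹ • z).1 1 then 0 else 1
    rw [if_neg this]
    exact one_pos

end Compactness

/-! ### Averages over finite sets -/

theorem dTwo_le {X : Type u} {V : Type v} [Finite V] [Nonempty V] (d : PseudoMetric X ℝ)
    (φ ψ : V → X) (B : Set V) {τ D δ : ℝ} (hδ : 0 ≤ δ) (h1 : ∀ v ∉ B, d (φ v) (ψ v) ≤ τ)
    (h2 : ∀ v, d (φ v) (ψ v) ≤ D)
    (h : τ ^ 2 * Nat.card V + B.ncard * D ^ 2 ≤ δ ^ 2 * Nat.card V) : dTwo d φ ψ ≤ δ := by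
  classical
  have := Fintype.ofFinite V
  have hN : (0 : ℝ) < Nat.card V := by exact_mod_cast Nat.card_pos
  rw [dTwo, Real.sqrt_le_left hδ, div_le_iff₀ hN, finsum_eq_sum_of_fintype]
  refine le_trans ?_ h
  calc ∑ v, d (φ v) (ψ v) ^ 2 ≤ ∑ v, (τ ^ 2 + if v ∈ B then D ^ 2 else 0) := by
        refine Finset.sum_le_sum fun v _ => ?_
        have h0 := d.nonneg (φ v) (ψ v)
        split_ifs with hv
        · nlinarith [h2 v, sq_nonneg τ]
        · nlinarith [h1 v hv]
    _ = τ ^ 2 * Nat.card V + B.ncard * D ^ 2 := by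
        rw [Finset.sum_add_distrib, Finset.sum_const, ← Finset.sum_filter, Finset.sum_const,
          Finset.card_univ, Nat.card_eq_fintype_card, Set.ncard_eq_toFinset_card',
          nsmul_eq_mul, nsmul_eq_mul, mul_comm]
        congr 4
        ext v
        simp

/-- Chebyshev's inequality. -/
theorem ncard_lt_mul_sq_le {X : Type u} {V : Type v} [Finite V] [Nonempty V]
    (d : PseudoMetric X ℝ) (φ ψ : V → X) {κ δ : ℝ} (hκ : 0 ≤ κ) (hδ : 0 ≤ δ)
    (h : dTwo d φ ψ ≤ δ) :
    ({v | κ < d (φ v) (ψ v)}.ncard : ℝ) * κ ^ 2 ≤ δ ^ 2 * Nat.card V := by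
  classical
  have := Fintype.ofFinite V
  have hN : (0 : ℝ) < Nat.card V := by exact_mod_cast Nat.card_pos
  rw [dTwo, Real.sqrt_le_left hδ, div_le_iff₀ hN, finsum_eq_sum_of_fintype] at h
  refine le_trans ?_ h
  rw [Set.ncard_eq_toFinset_card', ← nsmul_eq_mul, ← Finset.sum_const]
  refine (Finset.sum_le_sum fun v hv => ?_).trans
    (Finset.sum_le_sum_of_subset_of_nonneg (Finset.subset_univ _) fun v _ _ => sq_nonneg _)
  have : κ < d (φ v) (ψ v) := by simpa using hv
  gcongr

/-! ### The lower bound -/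

namespace HoleTower

variable {G : Type u} [Group G] {H : ℕ → Subgroup G} {a : ℕ → ℕ} (A : HoleTower H a)

/-- At a good coset, genericity gives an orbit point that reads `w` in the holes of the window; off
the holes it agrees with `w` by periodicity. At other cosets the point is arbitrary. -/
theorem exists_model [∀ n, (H n).Normal] {k : ℕ} {x : FullShift k G} {n : ℕ}
    (hx : ∀ (W : Finset G) (g₀ : G), A.Good n W g₀ →
      ∀ p : G → Fin k, ∃ g : G, (g : G ⧸ H n) = g₀ ∧ ∀ f ∈ W,
        ((g * f : G) : G ⧸ H n) ∈ A.hole n → x (g * f) = p f)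
    (W : Finset G) (w : G ⧸ H n → Fin k) (hw : ∀ g : G, (g : G ⧸ H n) ∉ A.hole n → w g = x g) :
    ∃ φ : G ⧸ H n → orbitClosure x, ∀ g : G, A.Good n W g → ∀ f ∈ W,
      (φ g).1 f = w (g * f : G) := by
  have h : ∀ c : G ⧸ H n, ∃ y : orbitClosure x, ∀ g : G, (g : G ⧸ H n) = c → A.Good n W g →
      ∀ f ∈ W, y.1 f = w (g * f : G) := by
    intro c
    induction c using QuotientGroup.induction_on with
    | H g₀ =>
      by_cases hg : A.Good n W g₀
      swap
      · exact ⟨orbitPoint x 1, fun g h1 h2 => absurd (h2.congr h1) hg⟩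
      obtain ⟨g, h1, h2⟩ := hx W g₀ hg (fun f => w (g₀ * f : G))
      refine ⟨orbitPoint x g, fun g' hg' _ f hf => ?_⟩
      have e : ((g * f : G) : G ⧸ H n) = (g₀ * f : G) := by
        rw [QuotientGroup.mk_mul, h1, QuotientGroup.mk_mul]
      have e' : ((g' * f : G) : G ⧸ H n) = (g₀ * f : G) := by
        rw [QuotientGroup.mk_mul, hg', QuotientGroup.mk_mul]
      rw [orbitPoint_apply, e']
      by_cases hh : ((g * f : G) : G ⧸ H n) ∈ A.hole n
      · exact h2 f hf hh
      · rw [← e, hw _ hh]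
  choose φ hφ using h
  exact ⟨φ, fun g hg => hφ g g rfl hg⟩

theorem lower_bound_aux [∀ n, (H n).Normal] [∀ n, (H n).FiniteIndex] {k : ℕ}
    {x : FullShift k G} {n : ℕ}
    (hx : ∀ (W : Finset G) (g₀ : G), A.Good n W g₀ →
      ∀ p : G → Fin k, ∃ g : G, (g : G ⧸ H n) = g₀ ∧ ∀ f ∈ W,
        ((g * f : G) : G ⧸ H n) ∈ A.hole n → x (g * f) = p f)
    (hper : ∀ g g' : G, (g : G ⧸ H n) = g' → (g : G ⧸ H n) ∉ A.hole n → x g' = x g)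
    {d : PseudoMetric (orbitClosure x) ℝ} {K F W₀ W : Finset G} {κ τ D δ : ℝ} (hδ : 0 < δ)
    (hKF : K ⊆ F) (hWone : 1 ∈ W) (hW₀ : W₀ ⊆ W) (hW : ∀ s ∈ F, ∀ f ∈ W₀, s⁻¹ * f ∈ W)
    (hK : ∀ y z : orbitClosure x, y.1 1 ≠ z.1 1 → ∃ s ∈ K, κ < d (s • y) (s • z))
    (hW₀d : ∀ y z : orbitClosure x, (∀ f ∈ W₀, y.1 f = z.1 f) → d y z ≤ τ)
    (hτ : 3 * τ ≤ κ) (hκ : 0 < κ)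
    (hD : ∀ y z : orbitClosure x, d y z ≤ D) {b : ℕ}
    (hb : {c : G ⧸ H n | ∃ g : G, (g : G ⧸ H n) = c ∧ ¬ A.Good n W g}.ncard = b)
    (hbδ : τ ^ 2 * Nat.card (G ⧸ H n) + (2 * b : ℕ) * D ^ 2 ≤ δ ^ 2 * Nat.card (G ⧸ H n)) :
    ((k ^ (a n - (K.card + 1) * b) : ℕ) : ℕ∞) ≤
      sepNumber (κ / 4) (soficMap d F δ (cosetPerm (H n))) (dInfty d) := by
  classical
  set B := {c : G ⧸ H n | ∃ g : G, (g : G ⧸ H n) = c ∧ ¬ A.Good n W g}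
  have hgood : ∀ g : G, (g : G ⧸ H n) ∉ B → A.Good n W g := by
    intro g hg
    by_contra hcon
    exact hg ⟨g, rfl, hcon⟩
  have hcomp : ∀ s : G, ((cosetPerm (H n) s) ⁻¹' B).ncard = b := by
    intro s
    rw [Set.ncard_preimage_of_injective_subset_range (Equiv.injective _) (by simp), hb]
  -- Separation is tested at c and at its images under K, so all of these must be good; this costs
  -- at most (|K| + 1) b holes.
  set S : Set (G ⧸ H n) := A.hole n \ (B ∪ ⋃ s ∈ K, (cosetPerm (H n) s) ⁻¹' B)
  have hS : a n - (K.card + 1) * b ≤ S.ncard := by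
    have h1 : (B ∪ ⋃ s ∈ K, (cosetPerm (H n) s) ⁻¹' B).ncard ≤ (K.card + 1) * b := by
      refine (Set.ncard_union_le _ _).trans ?_
      have := Finset.set_ncard_biUnion_le K (fun s => (cosetPerm (H n) s) ⁻¹' B)
      simp only [hcomp, Finset.sum_const, smul_eq_mul] at this
      rw [hb]
      linarith
    have h2 : _ ≤ S.ncard := Set.le_ncard_sdiff (B ∪ ⋃ s ∈ K, (cosetPerm (H n) s) ⁻¹' B) (A.hole n)
      (Set.toFinite _)
    rw [A.ncard_hole] at h2
    omega
  let w : (S → Fin k) → G ⧸ H n → Fin k := fun u c => if h : c ∈ S then u ⟨c, h⟩ else x c.out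
  have hw : ∀ u, ∃ φ : G ⧸ H n → orbitClosure x, ∀ g : G, A.Good n W g → ∀ f ∈ W,
      (φ g).1 f = w u (g * f : G) := by
    intro u
    refine A.exists_model hx W (w u) fun g hg => ?_
    have : (g : G ⧸ H n) ∉ S := fun h => hg h.1
    simp only [w, dif_neg this]
    exact hper _ _ (Quotient.out_eq' (g : G ⧸ H n)).symm hg
  choose φ hφ using hw
  have heq : ∀ u, ∀ s ∈ F, ∀ c, c ∉ B → cosetPerm (H n) s c ∉ B →
      d (φ u (cosetPerm (H n) s c)) (s • φ u c) ≤ τ := by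
    intro u s hs c hc hc'
    induction c using QuotientGroup.induction_on with
    | H g =>
      refine hW₀d _ _ fun f hf => ?_
      rw [coe_smul_apply, hφ u g (hgood g hc) _ (hW s hs f hf), cosetPerm_mk,
        hφ u _ (hgood _ hc') f (hW₀ hf), mul_assoc]
  have hmap : ∀ u, φ u ∈ soficMap d F δ (cosetPerm (H n)) := by
    intro u s hs
    refine dTwo_le d _ _ (B ∪ (cosetPerm (H n) s) ⁻¹' B) (τ := τ) hδ.le (fun c hc => ?_)
      (fun c => hD _ _) (le_trans ?_ hbδ)
    · rw [Set.mem_union, not_or] at hc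
      exact heq u s hs c hc.1 hc.2
    · have : (B ∪ (cosetPerm (H n) s) ⁻¹' B).ncard ≤ 2 * b := by
        refine (Set.ncard_union_le _ _).trans ?_
        rw [hcomp, hb]
        omega
      gcongr
  have hsep : ∀ u u', u ≠ u' → κ / 4 < dInfty d (φ u) (φ u') := by
    intro u u' hne
    obtain ⟨⟨c, hc⟩, hcne⟩ := Function.ne_iff.1 hne
    have hcB : c ∉ B := fun h => hc.2 (Or.inl h)
    have hval : ∀ u, (φ u c).1 1 = u ⟨c, hc⟩ := by
      intro u
      induction c using QuotientGroup.induction_on with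
      | H g =>
        rw [hφ u g (hgood g hcB) 1 hWone, mul_one]
        simp only [w, dif_pos hc]
    obtain ⟨s, hs, hlt⟩ := hK (φ u c) (φ u' c) (by rw [hval, hval]; exact hcne)
    have hcs : cosetPerm (H n) s c ∉ B := fun h =>
      hc.2 (Or.inr (Set.mem_biUnion (show s ∈ (K : Set G) from hs) h))
    have h1 := heq u s (hKF hs) c hcB hcs
    have h2 := heq u' s (hKF hs) c hcB hcs
    -- Two equivariance errors of at most τ leave a distance above κ - 2τ ≥ κ/3 > κ/4.
    have h3 := d.triangle (s • φ u c) (φ u (cosetPerm (H n) s c)) (s • φ u' c)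
    have h4 := d.triangle (φ u (cosetPerm (H n) s c)) (φ u' (cosetPerm (H n) s c)) (s • φ u' c)
    rw [d.symm (s • φ u c) (φ u _)] at h3
    have h5 : d (φ u (cosetPerm (H n) s c)) (φ u' (cosetPerm (H n) s c)) ≤
        dInfty d (φ u) (φ u') :=
      le_ciSup (f := fun c => d (φ u c) (φ u' c)) (Set.toFinite _).bddAbove _
    linarith
  have hinj : Function.Injective φ := by
    intro u u' h
    by_contra hne
    have h1 := hsep u u' hne
    rw [h] at h1
    have h2 : dInfty d (φ u') (φ u') = 0 := by
      simp [dInfty]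
    linarith
  have hcard : ((k ^ S.ncard : ℕ) : ℕ∞) = (Set.range φ).encard := by
    rw [← Set.image_univ, hinj.encard_image, Set.encard_univ, ENat.card_eq_coe_natCard,
      Nat.card_fun, Nat.card_fin, Nat.card_coe_set_eq]
  have hk : 0 < k := (x 1).pos
  refine le_trans (Nat.cast_le.2 (Nat.pow_le_pow_right hk hS)) ?_
  rw [hcard]
  refine le_iSup₂_of_le (Set.range φ) ⟨?_, ?_⟩ le_rfl
  · rintro _ ⟨u, rfl⟩
    exact hmap u
  · rintro _ ⟨u, rfl⟩ _ ⟨u', rfl⟩ hne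
    exact hsep u u' fun h => hne (h ▸ rfl)

/-- The scale κ/4 comes from `exists_separation` alone, so it precedes the choice of F and δ, as the
order of quantifiers in the entropy requires. -/
theorem lower_bound [∀ n, (H n).Normal] [∀ n, (H n).FiniteIndex] (hH : Antitone H)
    (ha : ∀ n, a (n + 1) < a n * (H (n + 1)).relIndex (H n)) {θ : ℝ}
    (hθ : Tendsto (fun n => (a n : ℝ) / (H n).index) atTop (𝓝 θ)) {k : ℕ}
    {x : FullShift k G}
    (hx : ∀ n (W : Finset G) (g₀ : G), A.Good n W g₀ →
      ∀ p : G → Fin k, ∃ g : G, (g : G ⧸ H n) = g₀ ∧ ∀ f ∈ W,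
        ((g * f : G) : G ⧸ H n) ∈ A.hole n → x (g * f) = p f)
    (hper : ∀ n (g g' : G), (g : G ⧸ H n) = g' → (g : G ⧸ H n) ∉ A.hole n → x g' = x g)
    {d : PseudoMetric (orbitClosure x) ℝ} (hd : IsGenerating G d) :
    ∃ ε : ℝ, 0 < ε ∧ ∀ (F : Finset G) (δ : ℝ), 0 < δ → ∀ η : ℝ, 0 < η → ∀ᶠ n in atTop,
      ∃ j : ℕ, ((k ^ j : ℕ) : ℕ∞) ≤ sepNumber ε (soficMap d F δ (cosetPerm (H n))) (dInfty d) ∧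
        (θ - η) * (H n).index ≤ j := by
  classical
  obtain ⟨K, κ, hκ, hK⟩ := hd.exists_separation
  obtain ⟨D, hD⟩ := hd.exists_bound
  refine ⟨κ / 4, by positivity, fun F₀ δ hδ η hη => ?_⟩
  set F := F₀ ∪ K
  set τ := min (δ / 2) (κ / 3)
  have hτ : 0 < τ := lt_min (by positivity) (by positivity)
  obtain ⟨W₀, hW₀⟩ := hd.exists_window hτ
  set W : Finset G := insert 1 (W₀ ∪ (F ×ˢ W₀).image fun q => q.1⁻¹ * q.2)
  have hlim : Tendsto (fun n => (W.card : ℝ) * ((a n : ℝ) / (H n).index - θ)) atTop (𝓝 0) := by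
    have := (hθ.sub_const θ).const_mul (W.card : ℝ)
    simpa using this
  -- The first bound makes the bad cosets contribute at most δ²/2 to the mean square, next to τ² ≤
  -- δ²/4; the second keeps the lost holes below η [G : H n].
  have hpos : 0 < min (δ ^ 2 / (4 * (D ^ 2 + 1))) (η / (K.card + 1)) :=
    lt_min (by positivity) (by positivity)
  filter_upwards [hlim.eventually (gt_mem_nhds hpos)] with n hn
  have hN : (0 : ℝ) < (H n).index := by
    exact_mod_cast Nat.pos_of_ne_zero Subgroup.FiniteIndex.index_ne_zero
  set b := {c : G ⧸ H n | ∃ g : G, (g : G ⧸ H n) = c ∧ ¬ A.Good n W g}.ncard with hb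
  set γ := (W.card : ℝ) * ((a n : ℝ) / (H n).index - θ) with hγ
  have hble : (b : ℝ) ≤ γ * (H n).index := by
    refine (A.ncard_not_good_le hH ha hθ n W).trans (le_of_eq ?_)
    rw [hγ]
    field_simp
  have hn1 : γ < δ ^ 2 / (4 * (D ^ 2 + 1)) := hn.trans_le (min_le_left _ _)
  have hn2 : γ < η / (K.card + 1) := hn.trans_le (min_le_right _ _)
  rw [lt_div_iff₀ (by positivity)] at hn1 hn2
  have hγ0 : 0 ≤ γ := by
    have := (density_antitone hH ha).le_of_tendsto hθ n
    exact mul_nonneg (by positivity) (by linarith)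
  refine ⟨a n - (K.card + 1) * b, ?_, ?_⟩
  · have hmono : soficMap d F δ (cosetPerm (H n)) ⊆ soficMap d F₀ δ (cosetPerm (H n)) :=
      fun φ hφ s hs => hφ s (Finset.mem_union_left _ hs)
    refine le_trans (A.lower_bound_aux (hx n) (hper n) hδ (F := F) (W := W) (W₀ := W₀) (τ := τ)
      Finset.subset_union_right (Finset.mem_insert_self _ _)
      (Finset.subset_union_left.trans (Finset.subset_insert _ _))
      (fun s hs f hf => Finset.mem_insert_of_mem (Finset.mem_union_right _
        (Finset.mem_image.2 ⟨(s, f), Finset.mk_mem_product hs hf, rfl⟩)))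
      hK (fun y z h => (hW₀ y z h).le) ?_ hκ hD hb.symm ?_)
      (iSup_mono fun E => iSup_mono' fun h => ⟨⟨h.1.trans hmono, h.2⟩, le_rfl⟩)
    · have := min_le_right (δ / 2) (κ / 3)
      linarith
    · change τ ^ 2 * ((H n).index : ℝ) + _ ≤ δ ^ 2 * ((H n).index : ℝ)
      push_cast
      have h1 : τ ^ 2 ≤ δ ^ 2 / 4 := by
        have := min_le_left (δ / 2) (κ / 3)
        nlinarith
      have h2 : γ * D ^ 2 ≤ δ ^ 2 / 4 := by nlinarith
      have h3 : (b : ℝ) * D ^ 2 ≤ δ ^ 2 / 4 * (H n).index := by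
        calc (b : ℝ) * D ^ 2 ≤ γ * (H n).index * D ^ 2 := by gcongr
          _ = γ * D ^ 2 * (H n).index := by ring
          _ ≤ _ := by gcongr
      have h4 : τ ^ 2 * (H n).index ≤ δ ^ 2 / 4 * (H n).index := by gcongr
      have h5 : 0 ≤ δ ^ 2 * (H n).index := by positivity
      linarith
  · have h1 : (a n : ℝ) ≤ (a n - (K.card + 1) * b : ℕ) + (K.card + 1) * b := by
      exact_mod_cast (by omega : a n ≤ (a n - (K.card + 1) * b) + (K.card + 1) * b)
    have h2 : θ * (H n).index ≤ a n := by
      rw [← le_div_iff₀ hN]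
      exact (density_antitone hH ha).le_of_tendsto hθ n
    have h3 : ((K.card : ℝ) + 1) * b ≤ η * (H n).index := by
      calc ((K.card : ℝ) + 1) * b ≤ (K.card + 1) * (γ * (H n).index) := by gcongr
        _ = γ * (K.card + 1) * (H n).index := by ring
        _ ≤ _ := by gcongr
    linarith

end HoleTower

/-! ### The upper bound -/

/-- A Chernoff bound: give each non-`none` symbol weight exp(-s). The total weight is (1 +
exp(-s)|P|)^|V|, and each sparse word weighs at least exp(-sγ|V|). -/
theorem card_sparse_le {V : Type v} {P : Type w} [Finite V] [Finite P] (γ s : ℝ) (hs : 0 ≤ s) :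
    (Nat.card {b : V → Option P // ({c | b c ≠ none}.ncard : ℝ) ≤ γ * Nat.card V} : ℝ) ≤
      Real.exp (Nat.card V * (s * γ + Real.exp (-s) * Nat.card P)) := by
  classical
  have := Fintype.ofFinite V
  have := Fintype.ofFinite P
  let wt : Option P → ℝ := fun o => if o = none then 1 else Real.exp (-s)
  have hsum : ∑ b : V → Option P, ∏ c, wt (b c) =
      (1 + Real.exp (-s) * Nat.card P) ^ Nat.card V := by
    rw [← Fintype.prod_sum (fun (_ : V) (o : Option P) => wt o), Finset.prod_const,
      Fintype.sum_option, Finset.card_univ, Nat.card_eq_fintype_card, Nat.card_eq_fintype_card]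
    simp [wt, mul_comm]
  have hprod : ∀ b : V → Option P,
      ∏ c, wt (b c) = Real.exp (-s * ({c | b c ≠ none}.ncard : ℝ)) := by
    intro b
    simp only [wt]
    rw [Finset.prod_ite, Finset.prod_const_one, one_mul, Finset.prod_const, ← Real.exp_nat_mul,
      Set.ncard_eq_toFinset_card']
    congr 1
    rw [mul_comm]
    congr 3
    ext c
    simp
  have hle : ((Finset.univ.filter fun b : V → Option P =>
      ({c | b c ≠ none}.ncard : ℝ) ≤ γ * Nat.card V).card : ℝ) *
        Real.exp (-s * (γ * Nat.card V)) ≤ (1 + Real.exp (-s) * Nat.card P) ^ Nat.card V := by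
    rw [← hsum, ← nsmul_eq_mul, ← Finset.sum_const]
    refine (Finset.sum_le_sum fun b hb => ?_).trans
      (Finset.sum_le_sum_of_subset_of_nonneg (Finset.subset_univ _) fun b _ _ => ?_)
    · rw [hprod, Real.exp_le_exp]
      have := (Finset.mem_filter.1 hb).2
      nlinarith
    · rw [hprod]
      positivity
  have hpow : (1 + Real.exp (-s) * Nat.card P) ^ Nat.card V ≤
      Real.exp (Nat.card V * (Real.exp (-s) * Nat.card P)) := by
    rw [Real.exp_nat_mul]
    have := Real.add_one_le_exp (Real.exp (-s) * Nat.card P)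
    rw [add_comm]
    gcongr
  rw [Nat.card_eq_fintype_card, Fintype.card_subtype]
  have h := hle.trans hpow
  have e : Real.exp (Nat.card V * (s * γ + Real.exp (-s) * Nat.card P)) *
      Real.exp (-s * (γ * Nat.card V)) =
      Real.exp (Nat.card V * (Real.exp (-s) * Nat.card P)) := by
    rw [← Real.exp_add]
    congr 1
    ring
  rw [← e] at h
  exact le_of_mul_le_mul_right h (Real.exp_pos _)

/-- The patterns of `x` over translates of a transversal of `L`. -/
def transversalPatterns {G : Type u} [Group G] (L : Subgroup G) {k : ℕ} (x : FullShift k G) :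
    Set (G ⧸ L → Fin k) :=
  Set.range fun (g : G) (i : G ⧸ L) => x (g * i.out)

/-- A pattern is determined by the coset of g and the letters at positions in S: each coset is
visited once, and off S the coset fixes the letter. -/
theorem card_transversalPatterns_le {G : Type u} [Group G] (L : Subgroup G) [L.Normal]
    [L.FiniteIndex] {k : ℕ} (x : FullShift k G) (S : Set (G ⧸ L))
    (hper : ∀ g g' : G, (g : G ⧸ L) = g' → (g : G ⧸ L) ∉ S → x g' = x g) :
    Nat.card (transversalPatterns L x) ≤ L.index * k ^ S.ncard := by
  classical
  have hout : ∀ i : G ⧸ L, ((i.out : G) : G ⧸ L) = i := fun i => Quotient.out_eq' i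
  let dec : (G ⧸ L) × (S → Fin k) → (G ⧸ L → Fin k) := fun p i =>
    if h : p.1 * i ∈ S then p.2 ⟨p.1 * i, h⟩ else x (p.1 * i).out
  have hsub : transversalPatterns L x ⊆ Set.range dec := by
    rintro _ ⟨g, rfl⟩
    refine ⟨((g : G ⧸ L), fun j => x (g * ((g : G ⧸ L)⁻¹ * j.1).out)), ?_⟩
    funext i
    by_cases h : (g : G ⧸ L) * i ∈ S
    · simp only [dec, dif_pos h, inv_mul_cancel_left]
    · simp only [dec, dif_neg h]
      refine hper _ _ ?_ ?_
      · rw [QuotientGroup.mk_mul, hout, hout]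
      · rwa [QuotientGroup.mk_mul, hout]
  have hcard : Nat.card ((G ⧸ L) × (S → Fin k)) = L.index * k ^ S.ncard := by
    rw [Nat.card_prod, Nat.card_fun, Nat.card_fin, Nat.card_coe_set_eq]
    rfl
  rw [← hcard, Nat.card_coe_set_eq]
  refine (Set.ncard_le_ncard hsub (Set.toFinite _)).trans ?_
  rw [← Set.image_univ, ← Set.ncard_univ]
  exact Set.ncard_image_le (Set.toFinite _)

theorem mem_transversalPatterns {G : Type u} [Group G] (L : Subgroup G) [L.FiniteIndex] {k : ℕ}
    {x : FullShift k G} (y : orbitClosure x) :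
    (fun i : G ⧸ L => y.1 i.out) ∈ transversalPatterns L x := by
  have hy : y.1 ∈ closure (MulAction.orbit G x) := y.2
  have hopen : IsOpen (⋂ i : G ⧸ L, {z : FullShift k G | z i.out = y.1 i.out}) :=
    isOpen_iInter_of_finite fun i => (isOpen_discrete {y.1 i.out}).preimage
      (continuous_apply (A := fun _ : G => Fin k) (i.out : G))
  obtain ⟨z, hz, g, rfl⟩ := mem_closure_iff.1 hy _ hopen (Set.mem_iInter.2 fun i => rfl)
  exact ⟨g⁻¹, funext fun i => Set.mem_iInter.1 hz i⟩

/-! ### Coding almost equivariant maps -/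

section Coding

variable {G : Type u} [Group G] {K L : Subgroup G} [K.Normal] [L.Normal] {k : ℕ}

open Classical in
/-- At each coset, the values around it if `u` fails to be equivariant there on the window `E`. -/
noncomputable def defectCode (E : Finset G) (u : G ⧸ K → G → Fin k) (c : G ⧸ K) :
    Option (E → Fin k × Fin k) :=
  if ∀ f ∈ E, u (c * (f : G)) 1 = u c f then none
  else some fun f => (u (c * (f : G)) 1, u c f)

theorem defectCode_ne_none {E : Finset G} {u : G ⧸ K → G → Fin k} {c : G ⧸ K} :
    defectCode E u c ≠ none ↔ ∃ f ∈ E, u (c * (f : G)) 1 ≠ u c f := by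
  simp [defectCode]

/-- Equal codes at c mean that both maps are equivariant there or that their recorded values agree.
Each coset is t times a transversal element with t in L/K, so its letter at 1 is either transported
from the pattern at t or recorded at t. -/
theorem eq_of_codes_eq (h : K ≤ L) (E : Finset G) (hE : ∀ i : G ⧸ L, (i.out : G) ∈ E)
    {u u' : G ⧸ K → G → Fin k} (hb : ∀ c, defectCode E u c = defectCode E u' c)
    (hq : ∀ t : G ⧸ K, Subgroup.quotientMapOfLE h t = (1 : G) →
      ∀ i : G ⧸ L, u t i.out = u' t i.out) (c : G ⧸ K) :
    ∀ f ∈ E, u c f = u' c f := by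
  have key : ∀ c, (∀ f ∈ E, u (c * (f : G)) 1 = u c f ∧ u' (c * (f : G)) 1 = u' c f) ∨
      ∀ f ∈ E, u (c * (f : G)) 1 = u' (c * (f : G)) 1 ∧ u c f = u' c f := by
    intro c
    have hc := hb c
    by_cases h1 : ∀ f ∈ E, u (c * (f : G)) 1 = u c f <;>
      by_cases h2 : ∀ f ∈ E, u' (c * (f : G)) 1 = u' c f
    · exact Or.inl fun f hf => ⟨h1 f hf, h2 f hf⟩
    · rw [defectCode, defectCode, if_pos h1, if_neg h2] at hc
      cases hc
    · rw [defectCode, defectCode, if_neg h1, if_pos h2] at hc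
      cases hc
    · rw [defectCode, defectCode, if_neg h1, if_neg h2, Option.some_inj] at hc
      refine Or.inr fun f hf => ?_
      have := congrFun hc ⟨f, hf⟩
      exact Prod.mk.inj this
  have hone : ∀ c, u c 1 = u' c 1 := by
    intro c
    induction c using QuotientGroup.induction_on with
    | H g =>
      set i : G ⧸ L := QuotientGroup.mk g
      set t : G ⧸ K := QuotientGroup.mk (g * (i.out)⁻¹)
      have hout : ((i.out : G) : G ⧸ L) = g := Quotient.out_eq' i
      have ht : Subgroup.quotientMapOfLE h t = (1 : G) := by
        change ((g * (i.out)⁻¹ : G) : G ⧸ L) = _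
        rw [QuotientGroup.mk_mul, QuotientGroup.mk_inv, hout, mul_inv_cancel]
        rfl
      have hg : t * (i.out : G) = (g : G ⧸ K) := by
        rw [← QuotientGroup.mk_mul, inv_mul_cancel_right]
      rw [← hg]
      rcases key t with h1 | h1
      · rw [(h1 _ (hE i)).1, (h1 _ (hE i)).2]
        exact hq t ht i
      · exact (h1 _ (hE i)).1
  intro f hf
  rcases key c with h1 | h1
  · rw [← (h1 f hf).1, ← (h1 f hf).2]
    exact hone _
  · exact (h1 f hf).2

end Coding

/-- At a defect, φ(cf) and f⁻¹φ(c) differ at 1, so some s in S separates them by κ. Comparing with φ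
at the common image of c, equivariance fails by more than κ/2 for s at cf or for sf⁻¹ at c.
Chebyshev bounds each failure by 4δ²/κ². -/
theorem ncard_defect_le {G : Type u} [Group G] {K : Subgroup G} [K.Normal] [K.FiniteIndex]
    {k : ℕ} {x : FullShift k G} {d : PseudoMetric (orbitClosure x) ℝ} {E S F : Finset G}
    {κ δ : ℝ} (hκ : 0 < κ) (hδ : 0 ≤ δ)
    (hS : ∀ y z : orbitClosure x, y.1 1 ≠ z.1 1 → ∃ s ∈ S, κ < d (s • y) (s • z))
    (hF : ∀ s ∈ S, s ∈ F ∧ ∀ f ∈ E, s * f⁻¹ ∈ F)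
    {φ : G ⧸ K → orbitClosure x} (hφ : φ ∈ soficMap d F δ (cosetPerm K)) :
    ({c | defectCode E (fun c => (φ c).1) c ≠ none}.ncard : ℝ) ≤
      E.card * S.card * (8 * δ ^ 2 / κ ^ 2) * Nat.card (G ⧸ K) := by
  let X : G → Set (G ⧸ K) := fun s => {c | κ / 2 < d (φ (cosetPerm K s c)) (s • φ c)}
  have hX : ∀ s ∈ F, ((X s).ncard : ℝ) ≤ 4 * δ ^ 2 / κ ^ 2 * Nat.card (G ⧸ K) := by
    intro s hs
    have := ncard_lt_mul_sq_le d _ _ (by positivity : 0 ≤ κ / 2) hδ (hφ s hs)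
    rw [div_mul_eq_mul_div, le_div_iff₀ (by positivity)]
    have h' : ((X s).ncard : ℝ) * (κ / 2) ^ 2 ≤ δ ^ 2 * Nat.card (G ⧸ K) := this
    nlinarith
  have hsub : {c | defectCode E (fun c => (φ c).1) c ≠ none} ⊆
      ⋃ q ∈ E ×ˢ S, ((cosetPerm K q.1⁻¹) ⁻¹' X q.2 ∪ X (q.2 * q.1⁻¹)) := by
    intro c hc
    obtain ⟨f, hf, hne⟩ := defectCode_ne_none.1 hc
    have hne' : (φ (cosetPerm K f⁻¹ c)).1 1 ≠ (f⁻¹ • φ c).1 1 := by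
      rw [coe_smul_apply, inv_inv, mul_one]
      have : cosetPerm K f⁻¹ c = c * (f : G) := by
        change c * (((f⁻¹)⁻¹ : G) : G ⧸ K) = _
        rw [inv_inv]
      rw [this]
      exact hne
    obtain ⟨s, hs, hlt⟩ := hS _ _ hne'
    simp only [Set.mem_iUnion]
    refine ⟨(f, s), Finset.mk_mem_product hf hs, ?_⟩
    by_contra hcon
    rw [Set.mem_union, not_or] at hcon
    have h1 : d (φ (cosetPerm K s (cosetPerm K f⁻¹ c))) (s • φ (cosetPerm K f⁻¹ c)) ≤ κ / 2 :=
      not_lt.1 fun h => hcon.1 h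
    have h2 : d (φ (cosetPerm K (s * f⁻¹) c)) ((s * f⁻¹) • φ c) ≤ κ / 2 :=
      not_lt.1 fun h => hcon.2 h
    have e : cosetPerm K s (cosetPerm K f⁻¹ c) = cosetPerm K (s * f⁻¹) c := by
      induction c using QuotientGroup.induction_on with
      | H g => simp only [cosetPerm_mk, mul_inv_rev, mul_assoc]
    rw [e, d.symm] at h1
    have h3 := d.triangle (s • φ (cosetPerm K f⁻¹ c)) (φ (cosetPerm K (s * f⁻¹) c))
      (s • f⁻¹ • φ c)
    rw [smul_smul] at h3 hlt
    linarith
  have hle := (Set.ncard_le_ncard hsub (Set.toFinite _)).trans (Finset.set_ncard_biUnion_le _ _)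
  calc ({c | defectCode E (fun c => (φ c).1) c ≠ none}.ncard : ℝ)
      ≤ ∑ q ∈ E ×ˢ S, (((cosetPerm K q.1⁻¹) ⁻¹' X q.2 ∪ X (q.2 * q.1⁻¹)).ncard : ℝ) := by
        exact_mod_cast hle
    _ ≤ ∑ q ∈ E ×ˢ S, (8 * δ ^ 2 / κ ^ 2 * Nat.card (G ⧸ K)) := by
        refine Finset.sum_le_sum fun q hq => ?_
        obtain ⟨hq1, hq2⟩ := Finset.mem_product.1 hq
        have h1 := hX q.2 (hF _ hq2).1
        have h2 := hX (q.2 * q.1⁻¹) ((hF _ hq2).2 _ hq1)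
        have h3 : (((cosetPerm K q.1⁻¹) ⁻¹' X q.2).ncard) = (X q.2).ncard :=
          Set.ncard_preimage_of_injective_subset_range (Equiv.injective _) (by simp)
        have h4 : (((cosetPerm K q.1⁻¹) ⁻¹' X q.2 ∪ X (q.2 * q.1⁻¹)).ncard : ℝ) ≤
            (X q.2).ncard + (X (q.2 * q.1⁻¹)).ncard := by
          rw [← h3]
          exact_mod_cast Set.ncard_union_le _ _
        have e : 8 * δ ^ 2 / κ ^ 2 * Nat.card (G ⧸ K) =
            4 * δ ^ 2 / κ ^ 2 * Nat.card (G ⧸ K) + 4 * δ ^ 2 / κ ^ 2 * Nat.card (G ⧸ K) := by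
          ring
        linarith
    _ = _ := by
        rw [Finset.sum_const, Finset.card_product, nsmul_eq_mul]
        push_cast
        ring

theorem sepNumber_le_card_codes {G : Type u} [Group G] {K L : Subgroup G} [K.Normal] [L.Normal]
    [K.FiniteIndex] [L.FiniteIndex] (h : K ≤ L)
    {k : ℕ} {x : FullShift k G} {d : PseudoMetric (orbitClosure x) ℝ} {E F : Finset G}
    {ε δ γ : ℝ} (hE : ∀ i : G ⧸ L, (i.out : G) ∈ E)
    (hEd : ∀ y z : orbitClosure x, (∀ f ∈ E, y.1 f = z.1 f) → d y z < ε)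
    (hdef : ∀ φ ∈ soficMap d F δ (cosetPerm K),
      ({c | defectCode E (fun c => (φ c).1) c ≠ none}.ncard : ℝ) ≤ γ * Nat.card (G ⧸ K)) :
    sepNumber ε (soficMap d F δ (cosetPerm K)) (dInfty d) ≤
      (Nat.card ({b : G ⧸ K → Option (E → Fin k × Fin k) //
        ({c | b c ≠ none}.ncard : ℝ) ≤ γ * Nat.card (G ⧸ K)} ×
        ((Subgroup.quotientMapOfLE h ⁻¹' {((1 : G) : G ⧸ L)} : Set (G ⧸ K)) →
          transversalPatterns L x)) : ℕ) := by
  refine iSup₂_le fun Z hZ => ?_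
  rw [← ENat.card_eq_coe_natCard]
  let code : Z → {b : G ⧸ K → Option (E → Fin k × Fin k) //
        ({c | b c ≠ none}.ncard : ℝ) ≤ γ * Nat.card (G ⧸ K)} ×
        ((Subgroup.quotientMapOfLE h ⁻¹' {((1 : G) : G ⧸ L)} : Set (G ⧸ K)) →
          transversalPatterns L x) := fun φ =>
    (⟨defectCode E (fun c => (φ.1 c).1), hdef φ.1 (hZ.1 φ.2)⟩,
      fun t => ⟨_, mem_transversalPatterns L (φ.1 t.1)⟩)
  refine ENat.card_le_card_of_injective (f := code) fun φ ψ hφψ => ?_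
  obtain ⟨h1, h2⟩ := Prod.mk.inj hφψ
  have h1' := Subtype.mk.inj h1
  have heq := eq_of_codes_eq h E hE (u := fun c => (φ.1 c).1) (u' := fun c => (ψ.1 c).1)
    (fun c => congrFun h1' c) (fun t ht i =>
      congrFun (Subtype.mk.inj (congrFun h2 ⟨t, ht⟩)) i)
  by_contra hne
  have hlt := hZ.2 φ.1 φ.2 ψ.1 ψ.2 (fun h => hne (Subtype.ext h))
  refine absurd hlt (not_lt.2 (ciSup_le fun c => (hEd _ _ (heq c)).le))

theorem tendsto_index_atTop {G : Type u} [Group G] {H : ℕ → Subgroup G}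
    [∀ n, (H n).FiniteIndex] (hH : StrictAnti H) :
    Tendsto (fun n => ((H n).index : ℝ)) atTop atTop := by
  refine tendsto_natCast_atTop_atTop.comp (StrictMono.tendsto_atTop ?_)
  exact fun n m hnm => Subgroup.index_strictAnti (hH hnm)

namespace HoleTower

variable {G : Type u} [Group G] {H : ℕ → Subgroup G} {a : ℕ → ℕ} (A : HoleTower H a)

theorem upper_bound [∀ n, (H n).Normal] [∀ n, (H n).FiniteIndex] (hH : StrictAnti H) {θ : ℝ}
    (hθ : Tendsto (fun n => (a n : ℝ) / (H n).index) atTop (𝓝 θ)) {k : ℕ} {x : FullShift k G}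
    (hper : ∀ n (g g' : G), (g : G ⧸ H n) = g' → (g : G ⧸ H n) ∉ A.hole n → x g' = x g)
    {d : PseudoMetric (orbitClosure x) ℝ} (hd : IsGenerating G d) {ε η : ℝ} (hε : 0 < ε)
    (hη : 0 < η) :
    ∃ (F : Finset G) (δ : ℝ), 0 < δ ∧ ∀ᶠ n in atTop, ∃ M : ℕ,
      sepNumber ε (soficMap d F δ (cosetPerm (H n))) (dInfty d) ≤ M ∧
        (M : ℝ) ≤ Real.exp ((θ * Real.log k + 4 * η) * (H n).index) := by
  classical
  obtain ⟨W, hW⟩ := hd.exists_window hε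
  obtain ⟨S, κ, hκ, hS⟩ := hd.exists_separation
  have hk : 0 < k := (x 1).pos
  have hlog : Tendsto (fun n => Real.log (H n).index / (H n).index) atTop (𝓝 0) :=
    (Real.isLittleO_log_id_atTop.tendsto_div_nhds_zero).comp (tendsto_index_atTop hH)
  have hθk := hθ.mul_const (Real.log k)
  -- Of the total error 4η, two parts come from this m: the factor [G : H m] in the pattern count,
  -- and the gap between a m / [G : H m] and θ. The other two are sγ and exp(-s)p. The constants are
  -- chosen in the order m, E, s, γ, δ.
  obtain ⟨m, hm1, hm2⟩ := ((hlog.eventually (gt_mem_nhds hη)).and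
    (hθk.eventually (gt_mem_nhds (lt_add_of_pos_right _ hη)))).exists
  have : Fintype (G ⧸ H m) := Fintype.ofFinite _
  set E : Finset G := W ∪ Finset.univ.image fun i : G ⧸ H m => (i.out : G)
  set p : ℝ := ((Nat.card (E → Fin k × Fin k) : ℕ) : ℝ)
  obtain ⟨s, hs0, hs⟩ : ∃ s : ℝ, 0 < s ∧ Real.exp (-s) * p < η := by
    have : Tendsto (fun s : ℝ => Real.exp (-s) * p) atTop (𝓝 (0 * p)) :=
      (Real.tendsto_exp_neg_atTop_nhds_zero).mul_const p
    rw [zero_mul] at this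
    obtain ⟨s, h1, h2⟩ := ((eventually_gt_atTop 0).and
      (this.eventually (gt_mem_nhds hη))).exists
    exact ⟨s, h1, h2⟩
  set γ := η / s
  have hγ : 0 < γ := by positivity
  obtain ⟨δ, hδ, hδγ⟩ : ∃ δ : ℝ, 0 < δ ∧ E.card * S.card * (8 * δ ^ 2 / κ ^ 2) ≤ γ := by
    have hc : Tendsto (fun δ : ℝ => (E.card : ℝ) * S.card * (8 * δ ^ 2 / κ ^ 2)) (𝓝[>] 0)
        (𝓝 (E.card * S.card * (8 * 0 ^ 2 / κ ^ 2))) := by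
      refine Tendsto.mono_left ?_ nhdsWithin_le_nhds
      exact Continuous.tendsto (f := fun δ : ℝ => (E.card : ℝ) * S.card * (8 * δ ^ 2 / κ ^ 2))
        (by fun_prop) 0
    rw [zero_pow two_ne_zero, mul_zero, zero_div, mul_zero] at hc
    obtain ⟨δ, h1, h2⟩ := ((hc.eventually (gt_mem_nhds hγ)).and self_mem_nhdsWithin).exists
    exact ⟨δ, h2, h1.le⟩
  refine ⟨S ∪ (S ×ˢ E).image fun q => q.1 * q.2⁻¹, δ, hδ, ?_⟩
  filter_upwards [eventually_ge_atTop m] with n hn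
  refine ⟨_, sepNumber_le_card_codes (hH.antitone hn) (E := E) (γ := γ)
    (fun i => Finset.mem_union_right _ (Finset.mem_image_of_mem _ (Finset.mem_univ i)))
    (fun y z h => hW y z fun f hf => h f (Finset.mem_union_left _ hf))
    (fun φ hφ => (ncard_defect_le hκ hδ.le hS (fun s hs => ⟨Finset.mem_union_left _ hs,
      fun f hf => Finset.mem_union_right _ (Finset.mem_image.2
        ⟨(s, f), Finset.mk_mem_product hs hf, rfl⟩)⟩) hφ).trans (by gcongr)), ?_⟩
  set r := (H n).relIndex (H m)
  have hrN : (r : ℝ) * (H m).index = (H n).index := by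
    exact_mod_cast Subgroup.relIndex_mul_index (hH.antitone hn)
  have hNm : (0 : ℝ) < (H m).index := by
    exact_mod_cast Nat.pos_of_ne_zero Subgroup.FiniteIndex.index_ne_zero
  have hN : (0 : ℝ) < (H n).index := by
    exact_mod_cast Nat.pos_of_ne_zero Subgroup.FiniteIndex.index_ne_zero
  rw [Nat.card_prod, Nat.card_fun, Nat.card_coe_set_eq (_ ⁻¹' _), ncard_preimage_quotientMapOfLE,
    Set.ncard_singleton, one_mul]
  push_cast
  have h1 := card_sparse_le (V := G ⧸ H n) (P := E → Fin k × Fin k) γ s hs0.le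
  have h2 : (Nat.card (transversalPatterns (H m) x) : ℝ) ≤
      Real.exp (Real.log (H m).index + a m * Real.log k) := by
    have := card_transversalPatterns_le (H m) x (A.hole m) (hper m)
    rw [A.ncard_hole] at this
    rw [Real.exp_add, Real.exp_log hNm, Real.exp_nat_mul, Real.exp_log (by exact_mod_cast hk)]
    exact_mod_cast this
  calc _ ≤ Real.exp ((H n).index * (s * γ + Real.exp (-s) * p)) *
        Real.exp (Real.log (H m).index + a m * Real.log k) ^ r := by
        gcongr
        exact h1
    _ = Real.exp ((s * γ + Real.exp (-s) * p + (Real.log (H m).index / (H m).index +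
          a m / (H m).index * Real.log k)) * (H n).index) := by
        rw [← Real.exp_nat_mul, ← Real.exp_add]
        congr 1
        rw [← hrN]
        field_simp
    _ ≤ _ := by
        rw [Real.exp_le_exp]
        have hsγ : s * γ = η := by
          simp only [γ]
          field_simp
        refine mul_le_mul_of_nonneg_right ?_ hN.le
        linarith

end HoleTower

/-! ### Entropy -/

theorem entropyOf_le {G : Type u} {X : Type v} [SMul G X] {V : ℕ → Type w} [∀ n, Finite (V n)]
    [∀ n, Nonempty (V n)] (σ : ∀ n, G → Equiv.Perm (V n)) (d : PseudoMetric X ℝ) (c : ℝ)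
    (h : ∀ ε : ℝ, 0 < ε → ∀ η : ℝ, 0 < η → ∃ (F : Finset G) (δ : ℝ), 0 < δ ∧
      ∀ᶠ n in atTop, ∃ M : ℕ, sepNumber ε (soficMap d F δ (σ n)) (dInfty d) ≤ M ∧
        (M : ℝ) ≤ Real.exp ((c + η) * Nat.card (V n))) :
    entropyOf σ d ≤ c := by
  refine iSup₂_le fun ε hε => le_of_forall_gt_imp_ge_of_dense fun y hy => ?_
  obtain ⟨r, hr1, hr2⟩ := EReal.lt_iff_exists_real_btwn.1 hy
  have hcr : 0 < r - c := sub_pos.2 (EReal.coe_lt_coe_iff.1 hr1)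
  obtain ⟨F, δ, hδ, hev⟩ := h ε hε (r - c) hcr
  refine (iInf_le_of_le F (iInf₂_le_of_le δ hδ ?_)).trans hr2.le
  refine limsup_le_of_le (by isBoundedDefault) ?_
  filter_upwards [hev] with n hn
  obtain ⟨M, h1, h2⟩ := hn
  rw [add_sub_cancel] at h2
  have hN : (0 : EReal) < Nat.card (V n) := by exact_mod_cast Nat.card_pos
  have e : ((M : ℕ∞) : ENNReal) = ENNReal.ofReal M := by simp
  rw [EReal.div_le_iff_le_mul hN (EReal.natCast_ne_top _)]
  calc ENNReal.log _ ≤ ENNReal.log (ENNReal.ofReal (Real.exp (r * Nat.card (V n)))) := by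
        refine ENNReal.log_le_log ((ENat.toENNReal_le.2 h1).trans ?_)
        rw [e]
        exact ENNReal.ofReal_le_ofReal h2
    _ = _ := by
        rw [ENNReal.log_ofReal_of_pos (Real.exp_pos _), Real.log_exp, EReal.coe_mul, mul_comm]
        rfl

/-- A real number strictly between the two extended reals absorbs η; dually in `entropyOf_le`. -/
theorem le_entropyOf {G : Type u} {X : Type v} [SMul G X] {V : ℕ → Type w} [∀ n, Finite (V n)]
    [∀ n, Nonempty (V n)] (σ : ∀ n, G → Equiv.Perm (V n)) (d : PseudoMetric X ℝ) (c : ℝ)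
    (h : ∃ ε : ℝ, 0 < ε ∧ ∀ (F : Finset G) (δ : ℝ), 0 < δ → ∀ η : ℝ, 0 < η →
      ∀ᶠ n in atTop, ∃ M : ℕ, (M : ℕ∞) ≤ sepNumber ε (soficMap d F δ (σ n)) (dInfty d) ∧
        Real.exp ((c - η) * Nat.card (V n)) ≤ M) :
    c ≤ entropyOf σ d := by
  obtain ⟨ε, hε, h⟩ := h
  refine le_iSup₂_of_le ε hε (le_iInf fun F => le_iInf₂ fun δ hδ => ?_)
  refine le_of_forall_lt_imp_le_of_dense fun y hy => ?_
  obtain ⟨r, hr1, hr2⟩ := EReal.lt_iff_exists_real_btwn.1 hy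
  have hcr : 0 < c - r := sub_pos.2 (EReal.coe_lt_coe_iff.1 hr2)
  refine hr1.le.trans (le_limsup_of_frequently_le (Eventually.frequently ?_) (by isBoundedDefault))
  filter_upwards [h F δ hδ (c - r) hcr] with n hn
  obtain ⟨M, h1, h2⟩ := hn
  rw [sub_sub_cancel] at h2
  have hN : (0 : EReal) < Nat.card (V n) := by exact_mod_cast Nat.card_pos
  have e : ((M : ℕ∞) : ENNReal) = ENNReal.ofReal M := by simp
  rw [EReal.le_div_iff_mul_le hN (EReal.natCast_ne_top _)]
  calc (r : EReal) * Nat.card (V n)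
      = ENNReal.log (ENNReal.ofReal (Real.exp (r * Nat.card (V n)))) := by
        rw [ENNReal.log_ofReal_of_pos (Real.exp_pos _), Real.log_exp, EReal.coe_mul]
        rfl
    _ ≤ _ := by
        refine ENNReal.log_le_log (le_trans ?_ (ENat.toENNReal_le.2 h1))
        rw [e]
        exact ENNReal.ofReal_le_ofReal h2

theorem HoleTower.hasSoficEntropy {G : Type u} [Group G] {H : ℕ → Subgroup G} {a : ℕ → ℕ}
    (A : HoleTower H a) [∀ n, (H n).Normal] [∀ n, (H n).FiniteIndex] (hH : StrictAnti H)
    (ha : ∀ n, a (n + 1) < a n * (H (n + 1)).relIndex (H n)) {θ : ℝ}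
    (hθ : Tendsto (fun n => (a n : ℝ) / (H n).index) atTop (𝓝 θ)) {k : ℕ} (hk : 1 < k)
    {x : FullShift k G}
    (hx : ∀ n (W : Finset G) (g₀ : G), A.Good n W g₀ →
      ∀ p : G → Fin k, ∃ g : G, (g : G ⧸ H n) = g₀ ∧ ∀ f ∈ W,
        ((g * f : G) : G ⧸ H n) ∈ A.hole n → x (g * f) = p f)
    (hper : ∀ n (g g' : G), (g : G ⧸ H n) = g' → (g : G ⧸ H n) ∉ A.hole n → x g' = x g) :
    HasSoficEntropy (fun n => cosetPerm (H n)) (orbitClosure x)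
      ((θ * Real.log k : ℝ) : EReal) := by
  refine ⟨exists_isGenerating x, fun d hd => le_antisymm ?_ ?_⟩
  · refine entropyOf_le _ _ _ fun ε hε η hη => ?_
    obtain ⟨F, δ, hδ, hev⟩ := A.upper_bound hH hθ hper hd hε (show 0 < η / 4 by positivity)
    refine ⟨F, δ, hδ, hev.mono fun n => ?_⟩
    rintro ⟨M, h1, h2⟩
    refine ⟨M, h1, ?_⟩
    rwa [mul_div_cancel₀ η (by norm_num : (4 : ℝ) ≠ 0)] at h2
  · have hlog : 0 < Real.log k := Real.log_pos (by exact_mod_cast hk)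
    obtain ⟨ε, hε, h⟩ := A.lower_bound hH.antitone ha hθ hx hper hd
    refine le_entropyOf _ _ _ ⟨ε, hε, fun F δ hδ η hη => ?_⟩
    -- The lower bound controls the exponent of k, so its error is scaled by log k.
    refine (h F δ hδ (η / Real.log k) (by positivity)).mono fun n => ?_
    rintro ⟨j, h1, h2⟩
    refine ⟨_, h1, ?_⟩
    have hk0 : (0 : ℝ) < k := by exact_mod_cast (zero_lt_one.trans hk)
    push_cast
    rw [← Real.exp_log hk0, ← Real.exp_nat_mul, Real.exp_log hk0, Real.exp_le_exp]
    have h3 := mul_le_mul_of_nonneg_right h2 hlog.le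
    refine le_trans (le_of_eq ?_) h3
    change _ * ((H n).index : ℝ) = _
    field_simp

/-! ### The coset actions form a sofic approximation -/

/-- Multiplicativity is exact at every n. If ts⁻¹ lies outside `H N`, the permutations of s and t
differ everywhere for all n ≥ N. -/
theorem isSoficApproximation_cosetPerm {G : Type u} [Group G] (H : ℕ → Subgroup G)
    [∀ n, (H n).Normal] [∀ n, (H n).FiniteIndex] (hH : Antitone H) (hbot : ⨅ n, H n = ⊥) :
    IsSoficApproximation (fun n => cosetPerm (H n)) := by
  have hone : ∀ n, ((Set.univ : Set (G ⧸ H n)).ncard : ℝ) / Nat.card (G ⧸ H n) = 1 := by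
    intro n
    rw [Set.ncard_univ]
    exact div_self (by exact_mod_cast Nat.card_pos.ne')
  refine ⟨fun n => inferInstance, fun s t => ?_, fun s t hst => ?_⟩
  · refine tendsto_const_nhds.congr fun n => ?_
    rw [← hone n]
    congr 3
    ext c
    induction c using QuotientGroup.induction_on with
    | H g =>
      simp only [Set.mem_univ, Set.mem_ofPred_eq, cosetPerm_mk, mul_inv_rev, mul_assoc]
  · have : t * s⁻¹ ∉ ⨅ n, H n := by
      rw [hbot, Subgroup.mem_bot, mul_inv_eq_one]
      exact hst.symm
    rw [Subgroup.mem_iInf] at this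
    push Not at this
    obtain ⟨N, hN⟩ := this
    refine tendsto_const_nhds.congr' ?_
    filter_upwards [eventually_ge_atTop N] with n hn
    rw [← hone n]
    congr 3
    ext c
    induction c using QuotientGroup.induction_on with
    | H g =>
      simp only [Set.mem_univ, true_iff, Set.mem_ofPred_eq, cosetPerm_mk, Ne, QuotientGroup.eq]
      intro h
      refine hN (hH hn ?_)
      simpa using h

end ToeplitzSofic

/-! ### The main theorem -/

theorem mainTheorem2 {G : Type u} [Group G] [Countable G]
    (H : ℕ → Subgroup G) [∀ n, (H n).Normal] [∀ n, (H n).FiniteIndex]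
    (hH : StrictAnti H) (hbot : ⨅ n, H n = ⊥)
    (a : ℕ → ℕ) (ha_pos : ∀ n, 0 < a n) (ha_zero : a 0 ≤ (H 0).index)
    (ha : ∀ n, a (n + 1) < a n * (H (n + 1)).relIndex (H n))
    (θ : ℝ) (hθ : Tendsto (fun n => (a n : ℝ) / (H n).index) atTop (𝓝 θ)) (hθ_lt : θ < 1)
    (k : ℕ) (hk : 1 < k) :
    ToeplitzSofic.IsSoficApproximation (fun n => ToeplitzSofic.cosetPerm (H n)) ∧
    ∃ x : ToeplitzSofic.FullShift k G,
      ToeplitzSofic.IsToeplitz H x ∧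
      (∀ n, (ToeplitzSofic.holes (H n) x).ncard = a n) ∧
      Tendsto (fun n => ((ToeplitzSofic.holes (H n) x).ncard : ℝ) / (H n).index) atTop (𝓝 θ) ∧
      ToeplitzSofic.HasSoficEntropy (fun n => ToeplitzSofic.cosetPerm (H n))
        (ToeplitzSofic.orbitClosure x) ((θ * Real.log k : ℝ) : EReal) := by
  obtain ⟨A⟩ := ToeplitzSofic.exists_holeTower H hH.antitone a ha_zero ha
  obtain ⟨v, hv⟩ := A.exists_filling_patterns hH hbot hk
  have hper := fun n => ToeplitzSofic.periodicPart_eq_of_tower (A.config v) (A.hole n)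
    (fun _ _ => A.config_congr hH v) (fun _ => A.exists_config_ne hH hk hv)
  have hholes : ∀ n, (ToeplitzSofic.holes (H n) (A.config v)).ncard = a n := fun n => by
    rw [ToeplitzSofic.holes_eq_of_periodicPart_eq _ _ (hper n), A.ncard_hole]
  refine ⟨ToeplitzSofic.isSoficApproximation_cosetPerm H hH.antitone hbot, A.config v, ?_,
    hholes, ?_, A.hasSoficEntropy hH ha hθ hk hv fun n _ _ => A.config_congr hH v⟩
  · refine Set.eq_univ_of_forall fun g => ?_
    obtain ⟨n, hn⟩ := A.exists_notMem g
    refine Set.mem_iUnion.2 ⟨n, ?_⟩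
    rw [hper n]
    exact hn
  · simpa only [hholes] using hθ
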